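/- **Notation.** Let $k,n\ge 1$ and $\mathsf P_k^+=\{\nu\in\mathbb Z^k: \nu_1\ge\cdots\ge\nu_k\ge 0\}$, $\mathcal A=\mathcal A_k^+(n)=\{\lambda\in\mathsf P^+_k: n\ge\lambda_1\ge\cdots\ge\lambda_k\ge1\}$, $|\lambda|=\sum_i\lambda_i$. Extend $\lambda\in\mathcal A$ to a map $\lambda:\mathbb Z\to\mathbb Z$ by $\lambda_{i+k}=\lambda_i-n$, let $\tau(m)=m-1$, and for $d\in\mathbb Z$ let $\lambda[d]=\lambda\circ\tau^d$, i.e. $\lambda[d]_i=\lambda_{i-d}$. Let $\tilde{\mathsf S}_k$ be the affine symmetric group of bijections $w:\mathbb Z\to\mathbb Z$ with $w(m+k)=w(m)+k$ and $\sum_{m=1}^k w(m)=\sum_{m=1}^k m$, with its length function with respect to the simple reflections $\sigma_i$ ($i$ mod $k$). For $\lambda,\mu\in\mathcal A$ and $d\ge 0$ let $\theta_{\lambda/d/\mu}$ be the number of minimal length representatives $w$ of the cosets $\mathsf S_\mu\backslash\tilde{\mathsf S}_k$ ($\mathsf S_\mu$ the stabiliser of $\mu$) with $\mu\circ w\le\lambda\circ\tau^d$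 pointwise. A cylindric reverse plane partition (CRPP) $\hat\pi$ of shape $\lambda/d/\mu$ is a sequence of cylindric loops $\mu[0]=\lambda^{(0)}[d_0]\le\lambda^{(1)}[d_1]\le\lambda^{(2)}[d_2]\le\cdots$ with $\lambda^{(i)}\in\mathcal A$, $0=d_0\le d_1\le d_2\le\cdots$, eventually constant and equal to $\lambda[d]$. Set $\mathrm{wt}_i(\hat\pi)=\#\{(a,b)\in\mathbb Z^2: 1\le a\le k,\ \lambda^{(i-1)}[d_{i-1}]_a<b\le\lambda^{(i)}[d_i]_a\}$, $u^{\hat\pi}=\prod_{i\ge1}u_i^{\mathrm{wt}_i(\hat\pi)}$ and $\theta_{\hat\pi}=\prod_{i\ge1}\theta_{\lambda^{(i)}/(d_i-d_{i-1})/\lambda^{(i-1)}}$. The cylindric complete symmetric function is $$h_{\lambda/d/\mu}(u)=\sum_{\hat\pi}\theta_{\hat\pi}\,u^{\hat\pi},$$ the sum over all CRPP of shape $\lambda/d/\mu$. For $\lambda,\mu,\nu\in\mathsf P^+_k$ let $N^\lambda_{\mu\nu}$ be the number of pairs $(w,w')\in\mathsf S^\mu\times\mathsf S^\nu$ such that $\mu\circ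 w+\nu\circ w'=\lambda+n\alpha$ for some $\alpha\in\mathbb Z^k$, where $\mathsf S^\mu\subset\mathsf S_k$ is the set of minimal length representatives of $\mathsf S_\mu\backslash\mathsf S_k$. Let $h_r$ be the complete symmetric function of degree $r$ in $u_1,u_2,\dots$ over $\mathbb C$, and $h_\nu=h_{\nu_1}\cdots h_{\nu_k}$. Let $R=\mathbb C[z,z^{-1}]$, $V=\mathbb C^n$ with basis $v_1,\dots,v_n$, and let $\mathfrak{gl}_n[z,z^{-1}]$ act on $R\otimes V^{\otimes k}$ by $x\mapsto\sum_i 1\otimes\cdots\otimes x\otimes\cdots\otimes1$. For $r=mn+s$ with $m\in\mathbb Z$, $0\le s<n$, let $P_r=z^m\big(\sum_{j-i=s}e_{ij}+z\sum_{i-j=n-s}e_{ij}\big)$. Let $H(u)=\sum_{r\ge0}u^r\sum_{\rho\vdash r}\mathrm z_\rho^{-1}P_{\rho_1}P_{\rho_2}\cdots$, with $\mathrm z_\rho=\prod_i i^{m_i(\rho)}m_i(\rho)!$, and let $H^*(u)$ be obtained from $H(u)$ by replacing each $P_r$ by $P_{-r}$. For $\lambda\in\mathcal A$ let $v_\lambda=\frac{d_\lambda}{k!}\sum_{w\in\mathsf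 S_k}v_{\lambda_{w(k)}}\otimes\cdots\otimes v_{\lambda_{w(1)}}$ with $d_\lambda=k!/\prod_i m_i(\lambda)!$, and, with the dual basis $v^1,\dots,v^n$, $v^\lambda=\frac1{k!}\sum_{w\in\mathsf S_k}v^{\lambda_{w(k)}}\otimes\cdots\otimes v^{\lambda_{w(1)}}$. Put $\lambda^\vee=(n+1-\lambda_k,\dots,n+1-\lambda_1)$, and let the bar be the antilinear involution with $\bar z=z^{-1}$, $\bar u_j=u_j$. **Theorem.** Let $\lambda,\mu\in\mathcal A_k^+(n)$. (i) For every integer $d\ge0$, each monomial in $u$ is the weight of only finitely many CRPP of shape $\lambda/d/\mu$, the series $h_{\lambda/d/\mu}$ is a symmetric function, and $$h_{\lambda/d/\mu}=\sum_{\nu\in\mathsf P^+_k,\ |\nu|=dn+|\lambda|-|\mu|}N^\lambda_{\mu\nu}\,h_\nu .$$ (ii) Each monomial in $u$ occurs in $h_{\lambda/d/\mu}(u)$ for only finitely many $d$, and $$\Big\langle v^{\lambda^\vee},\prod_{j\ge1}H(u_j)\,v_{\mu^\vee}\Big\rangle=\overline{\Big\langle v^{\lambda},\prod_{j\ge1}H^*(u_j)\,v_{\mu}\Big\rangle}=\sum_{d\ge0}z^d\,h_{\lambda/d/\mu}(u).$$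 -/

import Mathlib

open scoped LaurentPolynomial TensorProduct Nat

noncomputable section

/-! ### Length and minimal coset representatives -/

/-- Word length of `g` with respect to a generating set `S`. -/
def wordLength {G : Type*} [Group G] (S : Set G) (g : G) : ℕ :=
  sInf {l : ℕ | ∃ L : List G, (∀ s ∈ L, s ∈ S) ∧ L.prod = g ∧ L.length = l}

/-- The minimal length representatives in `K` of the right cosets `H g`. -/
def minCosetReps {G : Type*} [Group G] (S K H : Set G) : Set G :=
  {g | g ∈ K ∧ ∀ h ∈ H, wordLength S g ≤ wordLength S (h * g)}

/-! ### Weights and the alcove -/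

/-- `P_k^+`: partitions with at most `k` parts (`ν 0` is the first part). -/
def dominantWeights (k : ℕ) : Set (Fin k → ℕ) := {ν | Antitone ν}

/-- The alcove `A_k^+(n)`: partitions `n ≥ λ_1 ≥ ... ≥ λ_k ≥ 1`. -/
def alcove (k n : ℕ) : Set (Fin k → ℕ) := {lam | Antitone lam ∧ ∀ i, 1 ≤ lam i ∧ lam i ≤ n}

/-- The size `|λ|` of a weight. -/
def weightSize {k : ℕ} (lam : Fin k → ℕ) : ℕ := ∑ i, lam i

/-- `λ^∨ = (n+1-λ_k, ..., n+1-λ_1) = (1^{m_n(λ)} 2^{m_{n-1}(λ)} ... n^{m_1(λ)})`. -/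
def weightVee {k : ℕ} (n : ℕ) (lam : Fin k → ℕ) : Fin k → ℕ := fun i => n + 1 - lam (Fin.rev i)

/-! ### The fusion coefficients -/

/-- The simple transpositions of `S_k`. -/
def finiteSimple (k : ℕ) : Set (Equiv.Perm (Fin k)) :=
  {s | ∃ i j : Fin k, (j : ℕ) = (i : ℕ) + 1 ∧ s = Equiv.swap i j}

/-- `S^μ`: minimal length representatives of `S_μ \ S_k`, with `S_μ` the stabiliser of `μ`
under the right action `(μ, w) ↦ μ ∘ w`. -/
def finiteReps {k : ℕ} (mu : Fin k → ℕ) : Set (Equiv.Perm (Fin k)) :=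
  minCosetReps (finiteSimple k) Set.univ {s | mu ∘ s = mu}

/-- `N_{μν}^λ`: the number of pairs `(w, w') ∈ S^μ × S^ν` with `μ ∘ w + ν ∘ w' = λ ∘ x^α` for some
weight `α ∈ ℤ^k`; in the level-`n` action `λ ∘ x^α = λ + n α`. -/
def fusionCoeff {k : ℕ} (n : ℕ) (mu nu lam : Fin k → ℕ) : ℕ :=
  Set.ncard {p : Equiv.Perm (Fin k) × Equiv.Perm (Fin k) |
    p.1 ∈ finiteReps mu ∧ p.2 ∈ finiteReps nu ∧
      ∃ α : Fin k → ℤ, ∀ i, (mu (p.1 i) : ℤ) + (nu (p.2 i) : ℤ) = (lam i : ℤ) + (n : ℤ) * α i}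

/-! ### Cylindric loops and the affine symmetric group -/

/-- The extension of a weight `(λ_1, ..., λ_k)` to a map `ℤ → ℤ` with `λ_{i+k} = λ_i - n`. -/
def weightExt {k : ℕ} [NeZero k] (n : ℕ) (lam : Fin k → ℕ) (i : ℤ) : ℤ :=
  (lam ⟨((i - 1) % (k : ℤ)).toNat, by
    have hk : (0 : ℤ) < (k : ℤ) := by exact_mod_cast Nat.pos_of_ne_zero (NeZero.ne k)
    have h1 := Int.emod_nonneg (i - 1) hk.ne'
    have h2 := Int.emod_lt_of_pos (i - 1) hk
    omega⟩ : ℤ) - (n : ℤ) * ((i - 1) / (k : ℤ))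

/-- The cylindric loop `λ[d] = λ ∘ τ^d`, where `τ(m) = m - 1`; so `λ[d]_i = λ_{i-d}`. -/
def cylLoop {k : ℕ} [NeZero k] (n : ℕ) (lam : Fin k → ℕ) (d : ℤ) (i : ℤ) : ℤ :=
  weightExt n lam (i - d)

/-- The cylindric skew diagram `λ/d/μ` as a set of lattice points. -/
def cylShape {k : ℕ} [NeZero k] (n : ℕ) (lam : Fin k → ℕ) (d : ℤ) (mu : Fin k → ℕ) :
    Set (ℤ × ℤ) :=
  {p | cylLoop n mu 0 p.1 < p.2 ∧ p.2 ≤ cylLoop n lam d p.1}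

/-- The affine symmetric group, realised by bijections of `ℤ` with `w(m+k) = w(m) + k` and
`w(1) + ... + w(k) = 1 + ... + k`. -/
def affineSymm (k : ℕ) : Set (Equiv.Perm ℤ) :=
  {w | (∀ m : ℤ, w (m + k) = w m + k) ∧
    ∑ m ∈ Finset.Icc (1 : ℤ) k, w m = ∑ m ∈ Finset.Icc (1 : ℤ) k, m}

/-- The simple reflections `σ_i` of the affine symmetric group, `i` modulo `k`
(there are none for `k = 1`, where the group is trivial). -/
def affineSimple (k : ℕ) : Set (Equiv.Perm ℤ) :=
  {s | ∃ i : ℤ, ∀ m : ℤ,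
    (m ≡ i [ZMOD k] → s m = m + 1) ∧
    (m ≡ i + 1 [ZMOD k] → s m = m - 1) ∧
    (¬ m ≡ i [ZMOD k] → ¬ m ≡ i + 1 [ZMOD k] → s m = m)}

/-- Minimal length representatives of `S_μ \ S̃_k`, with `S_μ` the stabiliser of `μ` under the
level-`n` action `(μ, w) ↦ μ ∘ w`. -/
def affineReps {k : ℕ} [NeZero k] (n : ℕ) (mu : Fin k → ℕ) : Set (Equiv.Perm ℤ) :=
  minCosetReps (affineSimple k) (affineSymm k)
    {s | s ∈ affineSymm k ∧ weightExt n mu ∘ s = weightExt n mu}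

/-- `θ_{λ/d/μ}`: the number of minimal representatives `w` with `μ ∘ w ≤ λ ∘ τ^d`. -/
def cylTheta {k : ℕ} [NeZero k] (n : ℕ) (lam : Fin k → ℕ) (d : ℤ) (mu : Fin k → ℕ) : ℕ :=
  Set.ncard {w : Equiv.Perm ℤ | w ∈ affineReps n mu ∧
    ∀ i : ℤ, weightExt n mu (w i) ≤ cylLoop n lam d i}

/-! ### Cylindric reverse plane partitions -/

/-- A cylindric reverse plane partition of shape `λ/d/μ`, as a weakly increasing sequence of
cylindric loops `μ[0] = λ^{(0)}[d_0] ≤ λ^{(1)}[d_1] ≤ ...` that is eventually constant, equal to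
`λ[d]`. The boxes with entry `i + 1` are those between the loops number `i` and `i + 1`. -/
@[ext]
structure CylRPP (k n : ℕ) [NeZero k] (lam : Fin k → ℕ) (d : ℤ) (mu : Fin k → ℕ) where
  part : ℕ → Fin k → ℕ
  deg : ℕ → ℤ
  part_mem : ∀ i, part i ∈ alcove k n
  deg_mono : ∀ i, deg i ≤ deg (i + 1)
  loop_le : ∀ i a, cylLoop n (part i) (deg i) a ≤ cylLoop n (part (i + 1)) (deg (i + 1)) a
  part_zero : part 0 = mu
  deg_zero : deg 0 = 0
  eventually_eq : ∃ l, ∀ i, l ≤ i → part i = lam ∧ deg i = d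

/-- The number of boxes `(a, b)` with entry `i + 1` and `1 ≤ a ≤ k`. -/
def CylRPP.wt {k n : ℕ} [NeZero k] {lam : Fin k → ℕ} {d : ℤ} {mu : Fin k → ℕ}
    (p : CylRPP k n lam d mu) (i : ℕ) : ℕ :=
  Set.ncard {q : ℤ × ℤ | q ∈ cylShape n (p.part (i + 1)) (p.deg (i + 1) - p.deg i) (p.part i) ∧
    1 ≤ q.1 ∧ q.1 ≤ k}

/-- The weight `θ_π̂`, a product over the entries (almost all factors are `θ_{λ/0/λ} = 1`). -/
def CylRPP.theta {k n : ℕ} [NeZero k] {lam : Fin k → ℕ} {d : ℤ} {mu : Fin k → ℕ}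
    (p : CylRPP k n lam d mu) : ℕ :=
  ∏ᶠ i : ℕ, cylTheta n (p.part (i + 1)) (p.deg (i + 1) - p.deg i) (p.part i)

/-- The cylindric reverse plane partitions with `u^π̂ = u^α`. -/
def cylRPPOfWeight {k : ℕ} [NeZero k] (n : ℕ) (lam : Fin k → ℕ) (d : ℤ) (mu : Fin k → ℕ)
    (α : ℕ →₀ ℕ) : Set (CylRPP k n lam d mu) := {p | ∀ i, p.wt i = α i}

/-- The cylindric complete symmetric function `h_{λ/d/μ} = ∑_π̂ θ_π̂ u^π̂`, a formal power series
in the indeterminates `u_1, u_2, ...` (here `u_{j+1}` is the variable number `j`). -/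
def cylH {k : ℕ} [NeZero k] (n : ℕ) (lam : Fin k → ℕ) (d : ℤ) (mu : Fin k → ℕ) :
    MvPowerSeries ℕ ℂ :=
  fun α => ∑ᶠ p ∈ cylRPPOfWeight n lam d mu α, (p.theta : ℂ)

/-! ### Symmetric functions -/

/-- Membership in the ring of symmetric functions over `ℂ`: bounded degree and invariance under
permutations of the variables. -/
def IsSymmetricFunction (f : MvPowerSeries ℕ ℂ) : Prop :=
  (∃ D : ℕ, ∀ α : ℕ →₀ ℕ, D < α.degree → MvPowerSeries.coeff α f = 0) ∧
    ∀ (σ : Equiv.Perm ℕ) (α : ℕ →₀ ℕ),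
      MvPowerSeries.coeff (α.mapDomain σ) f = MvPowerSeries.coeff α f

/-- The complete symmetric function `h_r`: the sum of all monomials of degree `r`. -/
def completeH (r : ℕ) : MvPowerSeries ℕ ℂ := fun α => if α.degree = r then 1 else 0

/-- `h_ν = h_{ν_1} h_{ν_2} ... h_{ν_k}`. -/
def completeHPart {k : ℕ} (nu : Fin k → ℕ) : MvPowerSeries ℕ ℂ := ∏ i, completeH (nu i)

/-! ### The level-0 module and the principal subalgebra

The ground ring is `ℂ[z, z⁻¹] = ℂ[T;T⁻¹]`; a vector `v_m` with `1 ≤ m ≤ n` is the basis vector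
with index `m - 1 : Fin n`. -/

/-- The module `V[z,z⁻¹]^{⊗ k} = ℂ[z,z⁻¹] ⊗ V^{⊗ k}`, with `V = ℂ^n`. -/
abbrev LoopTensor (k n : ℕ) : Type :=
  PiTensorProduct ℂ[T;T⁻¹] (fun _ : Fin k => Fin n → ℂ[T;T⁻¹])

/-- The action of the loop algebra `gl_n[z,z⁻¹]` on the tensor product by the iterated coproduct:
`x` acts as `∑_i 1 ⊗ ... ⊗ x ⊗ ... ⊗ 1`. -/
def loopAction {n : ℕ} (k : ℕ) (x : Matrix (Fin n) (Fin n) ℂ[T;T⁻¹]) :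
    Module.End ℂ[T;T⁻¹] (LoopTensor k n) :=
  ∑ i : Fin k, PiTensorProduct.map (fun j => if j = i then x.mulVecLin else LinearMap.id)

/-- `P_r = z^m (∑_{j-i=s} e_{ij} + z ∑_{i-j=n-s} e_{ij})` for `r = m n + s`, `0 ≤ s < n`. -/
def heisenbergP (n : ℕ) (r : ℤ) : Matrix (Fin n) (Fin n) ℂ[T;T⁻¹] :=
  Matrix.of fun i j =>
    LaurentPolynomial.T (r / (n : ℤ)) *
      ((if ((j : ℕ) : ℤ) - ((i : ℕ) : ℤ) = r % (n : ℤ) then 1 else 0) +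
        LaurentPolynomial.T 1 *
          (if ((i : ℕ) : ℤ) - ((j : ℕ) : ℤ) = (n : ℤ) - r % (n : ℤ) then 1 else 0))

/-- `z_ρ = ∏_i i^{m_i(ρ)} m_i(ρ)!` for a partition `ρ` of `r`. -/
def partitionZ {r : ℕ} (ρ : r.Partition) : ℕ :=
  ∏ i ∈ ρ.parts.toFinset, i ^ ρ.parts.count i * (ρ.parts.count i)!

/-- The image of `H_r = ∑_{ρ ⊢ r} z_ρ⁻¹ P_{ρ_1} P_{ρ_2} ...` (for `ε = 1`), respectively of
`H_{-r} = ∑_{ρ ⊢ r} z_ρ⁻¹ P_{-ρ_1} P_{-ρ_2} ...` (for `ε = -1`), in the endomorphisms. -/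
def opH (k n : ℕ) (ε : ℤ) (r : ℕ) : Module.End ℂ[T;T⁻¹] (LoopTensor k n) :=
  ∑ ρ : r.Partition, (LaurentPolynomial.C ((partitionZ ρ : ℂ)⁻¹) : ℂ[T;T⁻¹]) •
    ((ρ.parts.sort (· ≥ ·)).map fun j => loopAction k (heisenbergP n (ε * j))).prod

/-- The coefficient of `u^α` in `∏_j H(u_j)` (for `ε = 1`) or `∏_j H^*(u_j)` (for `ε = -1`), where
`H(u) = ∑_r u^r H_r` and `H^*(u) = ∑_r u^r H_{-r}`: the ordered product of the `H_{± α_j}`. -/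
def opHProd (k n : ℕ) (ε : ℤ) (α : ℕ →₀ ℕ) : Module.End ℂ[T;T⁻¹] (LoopTensor k n) :=
  ((α.support.sort (· ≤ ·)).map fun j => opH k n ε (α j)).prod

/-- The basis vector `v_m`. -/
def basisVec (n m : ℕ) : Fin n → ℂ[T;T⁻¹] := fun i => if (i : ℕ) + 1 = m then 1 else 0

/-- The dual basis vector `v^m`. -/
def dualVec (n m : ℕ) : Module.Dual ℂ[T;T⁻¹] (Fin n → ℂ[T;T⁻¹]) :=
  ∑ i : Fin n, if (i : ℕ) + 1 = m then LinearMap.proj i else 0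

/-- `d_λ = k! / ∏_m m_m(λ)!` for a weight `λ` of the alcove. -/
def quantumDim {k : ℕ} (n : ℕ) (lam : Fin k → ℕ) : ℂ :=
  (k ! : ℂ) / ((∏ m ∈ Finset.Icc 1 n, (Finset.univ.filter fun i => lam i = m).card ! : ℕ) : ℂ)

/-- The divided power `v_λ = d_λ e_k^+ (v_{λ_k} ⊗ ... ⊗ v_{λ_1})`,
with `e_k^+ = (1/k!) ∑_{w ∈ S_k} w` acting by permutation of the factors. -/
def dividedPower {k : ℕ} (n : ℕ) (lam : Fin k → ℕ) : LoopTensor k n :=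
  (LaurentPolynomial.C (quantumDim n lam * (k ! : ℂ)⁻¹) : ℂ[T;T⁻¹]) •
    ∑ w : Equiv.Perm (Fin k),
      PiTensorProduct.tprod ℂ[T;T⁻¹] fun i => basisVec n (lam (Fin.rev (w i)))

/-- `v^λ = (1/k!) ∑_{w ∈ S_k} v^{λ_{w(k)}} ⊗ ... ⊗ v^{λ_{w(1)}}`, as a linear form on the tensor
product by the natural pairing. -/
def dualPower {k : ℕ} (n : ℕ) (lam : Fin k → ℕ) : Module.Dual ℂ[T;T⁻¹] (LoopTensor k n) :=
  (LaurentPolynomial.C ((k ! : ℂ)⁻¹) : ℂ[T;T⁻¹]) •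
    ∑ w : Equiv.Perm (Fin k),
      PiTensorProduct.dualDistrib
        (PiTensorProduct.tprod ℂ[T;T⁻¹] fun i => dualVec n (lam (w (Fin.rev i))))

/-- The matrix element `⟨v^λ, ∏_j H(u_j) v_μ⟩` (`ε = 1`) or `⟨v^λ, ∏_j H^*(u_j) v_μ⟩` (`ε = -1`),
a power series in the `u_j` with coefficients in `ℂ[z,z⁻¹]`. -/
def matrixElement {k : ℕ} (n : ℕ) (ε : ℤ) (lam mu : Fin k → ℕ) : MvPowerSeries ℕ ℂ[T;T⁻¹] :=
  fun α => dualPower n lam (opHProd k n ε α (dividedPower n mu))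

/-- The antilinear involution `z ↦ z⁻¹` of `ℂ[z,z⁻¹]`, complex conjugation on scalars. -/
def laurentBar : ℂ[T;T⁻¹] →+* ℂ[T;T⁻¹] :=
  LaurentPolynomial.eval₂ (LaurentPolynomial.C.comp (starRingEnd ℂ))
    (⟨LaurentPolynomial.T (-1), LaurentPolynomial.T 1, by
      rw [← LaurentPolynomial.T_add]; simp, by
      rw [← LaurentPolynomial.T_add]; simp⟩ : ℂ[T;T⁻¹]ˣ)

/-- The generating series `∑_{d ≥ 0} z^d h_{λ/d/μ}(u)`, coefficientwise in `u`. -/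
def cylHSeries {k : ℕ} [NeZero k] (n : ℕ) (lam mu : Fin k → ℕ) : MvPowerSeries ℕ ℂ[T;T⁻¹] :=
  fun α => ∑ᶠ d : ℕ, LaurentPolynomial.C (MvPowerSeries.coeff α (cylH n lam (d : ℤ) mu)) *
    LaurentPolynomial.T (d : ℤ)

end

open scoped LaurentPolynomial TensorProduct Nat

noncomputable section

/-! ### Exchange for permutation groups of a linear order -/

section Exchange

variable {X : Type*} [LinearOrder X]

/-! Everything reduces to one number. For c in ℤ^k let Φ_c be the linear form on polynomials in x_1,
..., x_k that sends x^G to 1 if c - G lies in the orbit of μ under permutations and translations by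
nℤ^k, and to 0 otherwise (`orbitCount`). All sides of the theorem have u^α-coefficient Φ_λ(∏_j
h_{α_j}(x_1, ..., x_k)), placed in the degree d with |λ| + dn = |α| + |μ|.

Combinatorial side. A minimal coset representative w is determined by μ ∘ w, by the exchange
property for words in simple reflections. Reading λ[d] - μ ∘ w on one period therefore identifies
θ_{λ/d/μ} with the number of g in ℕ^k of size |λ| + dn - |μ| such that λ - g lies in the orbit of μ
(`cylTheta_eq_ncard`). The alcove is a fundamental domain for the orbits, and Φ_c of a symmetric
polynomial depends only on the orbit of c. Hence multiplication by h_r acts under Φ as the transfer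
matrix of these counts, and the sum over paths in the alcove is Φ_λ of a product (`sum_paths`). A
path of nonzero weight is automatically a CRPP: a nonzero θ forces the inequality of loops, and the
sizes determine the degrees. This gives `coeff_cylH`, and symmetry in u is commutativity of the
product.

Expansion. The coefficient of x^G in ∏_j h_{α_j}(x) equals that of u^α in h_G(u), both counting
matrices over ℕ with given margins (`coeff_completeHPart`). Collecting the exponents G by their
decreasing rearrangement ν produces N^λ_{μν}.

Operator side. With v_m extended to integers m by v_{m-n} = z v_m, P_r shifts v_m to v_{m-r}. On
tensors v_c, with c in ℤ^k, P_r thus acts as the power sum p_r of the k shifts, and Newton's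
identities turn H_r into h_r of the shifts (`opH_monomialTensor`). Pairing with v^λ and cancelling
stabilisers leaves Φ_λ again (`matrixElement_eq`); passing from λ to λ^∨ changes the sign of the
shifts and so exchanges H and H^*. -/

theorem exists_word_reflection_mul {S : Set (Equiv.Perm X)} {R : X → X → Equiv.Perm X → Prop}
    (hS : ∀ s ∈ S, ∀ a b, a < b → s b < s a → R a b s)
    (hinv : ∀ s ∈ S, s * s = 1)
    (hconj : ∀ t ∈ S, ∀ a b s, R a b s → R (t a) (t b) (t * s * t⁻¹))
    (huniq : ∀ a b s s', R a b s → R a b s' → s = s')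
    (L : List (Equiv.Perm X)) :
    ∀ (_ : ∀ t ∈ L, t ∈ S) (a b : X) (_ : a < b) (r : Equiv.Perm X) (_ : R a b r)
      (_ : L.prod⁻¹ b < L.prod⁻¹ a),
      ∃ L' : List (Equiv.Perm X), (∀ t ∈ L', t ∈ S) ∧ L'.prod = r * L.prod ∧
        L'.length + 1 = L.length := by
  induction L with
  | nil => intro _ a b hab r _ hlt; simp at hlt; exact absurd hab hlt.not_gt
  | cons t L ih =>
    intro hL a b hab r hr hlt
    have ht : t ∈ S := hL t (by simp)
    have hti : t⁻¹ = t := inv_eq_of_mul_eq_one_left (hinv t ht)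
    have hL' : ∀ s ∈ L, s ∈ S := fun s hs => hL s (by simp [hs])
    rw [List.prod_cons, mul_inv_rev, Equiv.Perm.mul_apply, Equiv.Perm.mul_apply, hti] at hlt
    -- `R a b r` plays the role of "r is the reflection exchanging a and b". If the first letter t
    -- keeps a and b in order, r passes across t and becomes the reflection for t a, t b, to which
    -- induction applies. If t inverts them, r is t itself and cancels it.
    rcases lt_or_gt_of_ne (fun h => hab.ne (t.injective h) : t a ≠ t b) with h | h
    · obtain ⟨M, hM, hp, hl⟩ := ih hL' (t a) (t b) h _ (hconj t ht a b r hr) hlt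
      refine ⟨t :: M, ?_, ?_, by simp [hl]⟩
      · intro s hs
        rcases List.mem_cons.1 hs with rfl | hs
        · exact ht
        · exact hM s hs
      · rw [List.prod_cons, hp, hti, List.prod_cons]
        calc t * (t * r * t * L.prod) = (t * t) * (r * (t * L.prod)) := by group
          _ = _ := by rw [hinv t ht, one_mul]
    · have : r = t := huniq a b _ _ hr (hS t ht a b hab h)
      subst this
      refine ⟨L, hL', ?_, by simp⟩
      rw [List.prod_cons, ← mul_assoc, hinv r ht, one_mul]

theorem wordLength_le {G : Type*} [Group G] {S : Set G} (L : List G) (hL : ∀ s ∈ L, s ∈ S) :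
    wordLength S L.prod ≤ L.length :=
  Nat.sInf_le ⟨L, hL, rfl, rfl⟩

theorem exists_word_length_eq {G : Type*} [Group G] {S : Set G} {g : G}
    (h : ∃ L : List G, (∀ s ∈ L, s ∈ S) ∧ L.prod = g) :
    ∃ L : List G, (∀ s ∈ L, s ∈ S) ∧ L.prod = g ∧ L.length = wordLength S g := by
  obtain ⟨L, hL, hg⟩ := h
  exact Nat.sInf_mem (s := {l : ℕ | ∃ L : List G, (∀ s ∈ L, s ∈ S) ∧ L.prod = g ∧ L.length = l})
    ⟨_, L, hL, hg, rfl⟩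

/-- If the inequality failed, exchange would give a shorter word for `r * w`, an element of the same
coset. -/
theorem minCosetReps_inv_lt_inv {S K H : Set (Equiv.Perm X)} {R : X → X → Equiv.Perm X → Prop}
    (hS : ∀ s ∈ S, ∀ a b, a < b → s b < s a → R a b s)
    (hinv : ∀ s ∈ S, s * s = 1)
    (hconj : ∀ t ∈ S, ∀ a b s, R a b s → R (t a) (t b) (t * s * t⁻¹))
    (huniq : ∀ a b s s', R a b s → R a b s' → s = s')
    (hgen : ∀ g ∈ K, ∃ L : List (Equiv.Perm X), (∀ s ∈ L, s ∈ S) ∧ L.prod = g)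
    {w : Equiv.Perm X} (hw : w ∈ minCosetReps S K H) {a b : X} (hab : a < b)
    {r : Equiv.Perm X} (hr : R a b r) (hrH : r ∈ H) : w⁻¹ a < w⁻¹ b := by
  by_contra hcon
  have hlt : w⁻¹ b < w⁻¹ a :=
    lt_of_le_of_ne (not_lt.1 hcon) fun h => hab.ne' (w⁻¹.injective h)
  obtain ⟨L, hL, rfl, hlen⟩ := exists_word_length_eq (hgen w hw.1)
  obtain ⟨M, hM, hp, hl⟩ :=
    exists_word_reflection_mul hS hinv hconj huniq L hL a b hab r hr hlt
  have h1 := hw.2 r hrH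
  have h2 := wordLength_le M hM
  rw [hp] at h2
  omega

/-- The quotient preserves f. Between different level sets the order is forced by antitonicity, and
inside a level set both inverses are increasing. Uniqueness of minimal representatives is thereby
reduced to the rigidity of monotone permutations. -/
theorem strictMono_mul_inv_of_comp_eq {Y : Type*} [LinearOrder Y] {f : X → Y} (hf : Antitone f)
    {w w' : Equiv.Perm X} (h : f ∘ w = f ∘ w')
    (hw : ∀ a b, a < b → f a = f b → w⁻¹ a < w⁻¹ b)
    (hw' : ∀ a b, a < b → f a = f b → w'⁻¹ a < w'⁻¹ b) : StrictMono (w' * w⁻¹) := by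
  have hu : ∀ x, f ((w' * w⁻¹) x) = f x := fun x => by
    have := congrFun h (w⁻¹ x)
    simpa using this.symm
  intro x y hxy
  rcases (hf hxy.le).eq_or_lt with e | e
  · by_contra hcon
    have hlt : (w' * w⁻¹) y < (w' * w⁻¹) x :=
      lt_of_le_of_ne (not_lt.1 hcon) fun h => hxy.ne' ((w' * w⁻¹).injective h)
    have h1 := hw' _ _ hlt (by rw [hu, hu, e])
    simp at h1
    exact absurd (hw x y hxy e.symm) h1.not_gt
  · by_contra hcon
    have := hf (not_lt.1 hcon)
    rw [hu, hu] at this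
    exact absurd e this.not_gt

/-- Level sets of an antitone map are order-convex, so adjacent pairs suffice; for those the
exchanging reflection is simple and stabilises the weight. -/
theorem lt_of_lt_succ_of_antitone [SuccOrder X] [IsSuccArchimedean X]
    {Y Z : Type*} [LinearOrder Y] [LinearOrder Z] {f : X → Y} (hf : Antitone f) {g : X → Z}
    (hg : ∀ a, ¬ IsMax a → f a = f (Order.succ a) → g a < g (Order.succ a))
    (a b : X) (hab : a < b) (he : f a = f b) : g a < g b := by
  have hconn : (f ⁻¹' {f a}).OrdConnected := by
    refine ⟨fun x hx y hy z hz => ?_⟩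
    have hx' : f x = f a := hx
    have hy' : f y = f a := hy
    exact le_antisymm (hx' ▸ hf hz.1) (hy' ▸ hf hz.2)
  refine strictMonoOn_of_lt_succ hconn (fun c hc h1 h2 => hg c hc ?_) rfl he.symm hab
  have h1' : f c = f a := h1
  have h2' : f (Order.succ c) = f a := h2
  rw [h1', h2']

theorem exists_minCosetRep {G : Type*} [Group G] (S K H : Set G) (hHK : ∀ h ∈ H, ∀ g ∈ K, h * g ∈ K)
    (hone : 1 ∈ H) (hmul : ∀ h ∈ H, ∀ g ∈ H, h * g ∈ H) {g : G} (hg : g ∈ K) :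
    ∃ h ∈ H, h * g ∈ minCosetReps S K H := by
  let P : ℕ → Prop := fun l => ∃ h ∈ H, wordLength S (h * g) = l
  have hP : ∃ l, P l := ⟨_, 1, hone, rfl⟩
  classical
  obtain ⟨h, hh, hl⟩ := Nat.find_spec hP
  refine ⟨h, hh, hHK h hh g hg, fun h' hh' => ?_⟩
  rw [hl]
  exact Nat.find_min' hP ⟨h' * h, hmul h' hh' h hh, by rw [mul_assoc]⟩

end Exchange

/-! ### Minimal representatives in the symmetric group -/

theorem finiteSimple_generate (k : ℕ) [NeZero k] (g : Equiv.Perm (Fin k)) :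
    ∃ L : List (Equiv.Perm (Fin k)), (∀ s ∈ L, s ∈ finiteSimple k) ∧ L.prod = g := by
  obtain ⟨m, rfl⟩ := Nat.exists_eq_succ_of_ne_zero (NeZero.ne k)
  have h := Equiv.Perm.mclosure_swap_castSucc_succ m
  have hg : g ∈ Submonoid.closure
      (Set.range fun i : Fin m => Equiv.swap i.castSucc i.succ) := by rw [h]; trivial
  obtain ⟨L, hL, hp⟩ := Submonoid.exists_list_of_mem_closure hg
  refine ⟨L, fun s hs => ?_, hp⟩
  obtain ⟨i, rfl⟩ := hL s hs
  exact ⟨i.castSucc, i.succ, by simp, rfl⟩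

theorem exists_mem_finiteReps {k : ℕ} (mu : Fin k → ℕ) (g : Equiv.Perm (Fin k)) :
    ∃ w ∈ finiteReps mu, mu ∘ w = mu ∘ g := by
  obtain ⟨h, hh, hw⟩ := exists_minCosetRep (finiteSimple k) Set.univ
    {s : Equiv.Perm (Fin k) | mu ∘ s = mu} (fun _ _ _ _ => trivial) rfl
    (fun a ha b hb => by
      have ha' : mu ∘ a = mu := ha
      have hb' : mu ∘ b = mu := hb
      change mu ∘ (a ∘ b) = mu
      rw [← Function.comp_assoc, ha', hb']) (Set.mem_univ g)
  refine ⟨h * g, hw, ?_⟩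
  have hh' : mu ∘ h = mu := hh
  change mu ∘ (h ∘ g) = _
  rw [← Function.comp_assoc, hh']

/-- The reflections here are the transpositions, and a finite chain has no order automorphism except
the identity. -/
theorem finiteReps_injOn {k : ℕ} [NeZero k] {mu : Fin k → ℕ} (hmu : Antitone mu)
    {w w' : Equiv.Perm (Fin k)} (hw : w ∈ finiteReps mu) (hw' : w' ∈ finiteReps mu)
    (h : mu ∘ w = mu ∘ w') : w = w' := by
  have key : ∀ v ∈ finiteReps mu, ∀ a b, a < b → mu a = mu b → v⁻¹ a < v⁻¹ b := by
    intro v hv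
    refine lt_of_lt_succ_of_antitone hmu fun a ha he => ?_
    have hlt : a < Order.succ a := Order.lt_succ_of_not_isMax ha
    refine minCosetReps_inv_lt_inv (R := fun a b s => s = Equiv.swap a b)
      ?_ ?_ ?_ ?_ (fun g _ => finiteSimple_generate k g) hv hlt rfl ?_
    · rintro s ⟨i, j, hij, rfl⟩ a b hab hlt
      have hij' : i < j := by rw [Fin.lt_def]; omega
      simp only [Equiv.swap_apply_def] at hlt
      have hab' : a = i ∧ b = j := by
        simp only [Fin.ext_iff]
        split_ifs at hlt <;> simp only [Fin.lt_def, Fin.ext_iff] at * <;> omega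
      rw [hab'.1, hab'.2]
    · rintro s ⟨i, j, -, rfl⟩; simp
    · rintro t - a b s rfl
      rw [Equiv.swap_apply_apply]
    · rintro a b s s' rfl rfl; rfl
    · change mu ∘ _ = mu
      funext x
      simp only [Function.comp_apply, Equiv.swap_apply_def]
      split_ifs with h1 h2
      · rw [h1, ← he]
      · rw [h2, he]
      · rfl
  have hmono := strictMono_mul_inv_of_comp_eq hmu h (key w hw) (key w' hw')
  have h1 : w' * w⁻¹ = 1 := by
    let e : Fin k ≃o Fin k := (w' * w⁻¹).toOrderIso hmono.monotone (by
      intro x y hxy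
      exact hmono.le_iff_le.1 (by simpa using hxy))
    have he : e = OrderIso.refl _ := Subsingleton.elim _ _
    ext x
    exact congrArg Fin.val (DFunLike.congr_fun he x)
  exact (mul_inv_eq_one.1 h1).symm

/-! ### The affine symmetric group -/

theorem apply_add_mul_of_quasiperiodic {f : ℤ → ℤ} {k c : ℤ} (h : ∀ m, f (m + k) = f m + c)
    (m q : ℤ) : f (m + k * q) = f m + c * q := by
  induction q using Int.induction_on with
  | zero => simp
  | succ i ih => rw [mul_add, ← add_assoc, mul_one, h, ih]; ring
  | pred i ih =>
    have := h (m + k * (-(i : ℤ) - 1))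
    rw [show m + k * (-(i : ℤ) - 1) + k = m + k * (-(i : ℤ)) by ring, ih] at this
    linarith

/-- Moving the window by one exchanges p(a) for the equal value p(a + k). The sum condition of
`affineSymm` can then be tested on whichever window is convenient. -/
theorem sum_range_add_eq_of_periodic {k : ℕ} {p : ℤ → ℤ} (hp : ∀ m, p (m + k) = p m) (a : ℤ) :
    ∑ j ∈ Finset.range k, p (a + j) = ∑ m ∈ Finset.Icc (1 : ℤ) k, p m := by
  have hstep : ∀ a : ℤ, ∑ j ∈ Finset.range k, p (a + 1 + j) = ∑ j ∈ Finset.range k, p (a + j) := by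
    intro a
    have h1 := Finset.sum_range_succ (fun j : ℕ => p (a + j)) k
    have h2 := Finset.sum_range_succ' (fun j : ℕ => p (a + j)) k
    have h3 : ∀ j : ℕ, p (a + ((j + 1 : ℕ) : ℤ)) = p (a + 1 + j) := fun j => by
      push_cast; ring_nf
    simp only [h3, hp, Nat.cast_zero, add_zero] at h1 h2
    linarith
  have hbase : ∑ j ∈ Finset.range k, p (1 + j) = ∑ m ∈ Finset.Icc (1 : ℤ) k, p m := by
    refine Finset.sum_bij (fun j _ => 1 + (j : ℤ)) ?_ ?_ ?_ ?_
    · intro j hj; simp at hj ⊢; omega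
    · intro i _ j _ h; omega
    · intro m hm
      simp at hm
      exact ⟨(m - 1).toNat, by simp; omega, by omega⟩
    · intros; rfl
  rw [← hbase]
  have hz : ∀ q : ℤ, ∑ j ∈ Finset.range k, p (1 + q + j) = ∑ j ∈ Finset.range k, p (1 + j) := by
    intro q
    induction q using Int.induction_on with
    | zero => simp
    | succ i ih => rw [← ih, ← hstep (1 + i), ← add_assoc]
    | pred i ih =>
      rw [← ih, ← hstep (1 + (-(i : ℤ) - 1))]
      exact Finset.sum_congr rfl fun j _ => by congr 1; ring
  have := hz (a - 1)
  rwa [show 1 + (a - 1) = a by ring] at this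

theorem mem_affineSymm_iff {k : ℕ} {w : Equiv.Perm ℤ} (hw : ∀ m : ℤ, w (m + k) = w m + k) (a : ℤ) :
    w ∈ affineSymm k ↔ ∑ j ∈ Finset.range k, (w (a + j) - (a + j)) = 0 := by
  rw [sum_range_add_eq_of_periodic (p := fun m => w m - m) (fun m => by rw [hw]; ring) a,
    Finset.sum_sub_distrib, sub_eq_zero]
  exact ⟨fun h => h.2, fun h => ⟨hw, h⟩⟩

/-- `s` exchanges `a + kq` and `b + kq` for all `q` and fixes the other integers. -/
def IsAffineReflection (k : ℕ) (a b : ℤ) (s : Equiv.Perm ℤ) : Prop :=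
  (∀ m : ℤ, s (m + k) = s m + k) ∧ s a = b ∧ s b = a ∧
    ∀ m : ℤ, ¬ (k : ℤ) ∣ m - a → ¬ (k : ℤ) ∣ m - b → s m = m

theorem IsAffineReflection.apply_of_dvd {k : ℕ} {a b : ℤ} {s : Equiv.Perm ℤ}
    (h : IsAffineReflection k a b s) {m : ℤ} (hm : (k : ℤ) ∣ m - a) : s m = m - a + b := by
  obtain ⟨q, hq⟩ := hm
  have := apply_add_mul_of_quasiperiodic h.1 a q
  rw [h.2.1] at this
  rw [show m = a + k * q by linarith, this]; ring

theorem IsAffineReflection.apply_of_dvd' {k : ℕ} {a b : ℤ} {s : Equiv.Perm ℤ}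
    (h : IsAffineReflection k a b s) {m : ℤ} (hm : (k : ℤ) ∣ m - b) : s m = m - b + a :=
  IsAffineReflection.apply_of_dvd (k := k) (a := b) (b := a)
    ⟨h.1, h.2.2.1, h.2.1, fun m h1 h2 => h.2.2.2 m h2 h1⟩ hm

theorem IsAffineReflection.unique {k : ℕ} {a b : ℤ} {s s' : Equiv.Perm ℤ}
    (h : IsAffineReflection k a b s) (h' : IsAffineReflection k a b s') : s = s' := by
  ext m
  by_cases h1 : (k : ℤ) ∣ m - a
  · rw [h.apply_of_dvd h1, h'.apply_of_dvd h1]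
  · by_cases h2 : (k : ℤ) ∣ m - b
    · rw [h.apply_of_dvd' h2, h'.apply_of_dvd' h2]
    · rw [h.2.2.2 m h1 h2, h'.2.2.2 m h1 h2]

theorem inv_apply_add_period {k : ℤ} {t : Equiv.Perm ℤ} (ht : ∀ m : ℤ, t (m + k) = t m + k) (m : ℤ) :
    t⁻¹ (m + k) = t⁻¹ m + k := by
  rw [Equiv.Perm.inv_eq_iff_eq, ht]; simp

theorem dvd_apply_sub_apply {k : ℤ} {t : Equiv.Perm ℤ} (ht : ∀ m : ℤ, t (m + k) = t m + k)
    {x y : ℤ} (h : k ∣ x - y) : k ∣ t x - t y := by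
  obtain ⟨q, hq⟩ := h
  rw [show x = y + k * q by linarith, apply_add_mul_of_quasiperiodic ht]
  simp

theorem IsAffineReflection.conj {k : ℕ} {a b : ℤ} {s t : Equiv.Perm ℤ}
    (h : IsAffineReflection k a b s) (ht : ∀ m : ℤ, t (m + k) = t m + k) :
    IsAffineReflection k (t a) (t b) (t * s * t⁻¹) := by
  refine ⟨fun m => ?_, by simp [h.2.1], by simp [h.2.2.1], fun m h1 h2 => ?_⟩
  · simp only [Equiv.Perm.mul_apply, inv_apply_add_period ht, h.1, ht]
  · simp only [Equiv.Perm.mul_apply]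
    rw [h.2.2.2 (t⁻¹ m)]
    · simp
    · intro h3; exact h1 (by simpa using dvd_apply_sub_apply ht h3)
    · intro h3; exact h2 (by simpa using dvd_apply_sub_apply ht h3)

/-! ### Simple reflections of the affine group -/

theorem affineSimple_period {k : ℕ} {s : Equiv.Perm ℤ} (hs : s ∈ affineSimple k) (m : ℤ) :
    s (m + k) = s m + k := by
  obtain ⟨i, hi⟩ := hs
  have e1 : m + k ≡ m [ZMOD k] := by simp [Int.ModEq]
  obtain ⟨p1, p2, p3⟩ := hi m
  obtain ⟨q1, q2, q3⟩ := hi (m + k)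
  by_cases h1 : m ≡ i [ZMOD k]
  · rw [p1 h1, q1 (e1.trans h1)]; ring
  · by_cases h2 : m ≡ i + 1 [ZMOD k]
    · rw [p2 h2, q2 (e1.trans h2)]; ring
    · rw [p3 h1 h2, q3 (fun h => h1 (e1.symm.trans h)) (fun h => h2 (e1.symm.trans h))]

theorem affineSimple_mul_self {k : ℕ} {s : Equiv.Perm ℤ} (hs : s ∈ affineSimple k) :
    s * s = 1 := by
  obtain ⟨i, hi⟩ := hs
  ext m
  simp only [Equiv.Perm.mul_apply, Equiv.Perm.one_apply]
  obtain ⟨p1, p2, p3⟩ := hi m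
  by_cases h1 : m ≡ i [ZMOD k]
  · rw [p1 h1, (hi (m + 1)).2.1 (h1.add_right 1)]; ring
  · by_cases h2 : m ≡ i + 1 [ZMOD k]
    · rw [p2 h2, (hi (m - 1)).1 (by simpa using h2.sub_right 1)]; ring
    · rw [p3 h1 h2, p3 h1 h2]

/-- A simple reflection moves each integer by at most one, so the only pairs it inverts are a ≡ i, b
= a + 1. -/
theorem affineSimple_isAffineReflection {k : ℕ} {s : Equiv.Perm ℤ} (hs : s ∈ affineSimple k)
    {a b : ℤ} (hab : a < b) (h : s b < s a) : IsAffineReflection k a b s := by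
  have hper := affineSimple_period hs
  have hinv := affineSimple_mul_self hs
  obtain ⟨i, hi⟩ := hs
  have hcases : ∀ m, (s m = m + 1 ∧ m ≡ i [ZMOD k]) ∨ s m = m - 1 ∨ s m = m := fun m => by
    obtain ⟨p1, p2, p3⟩ := hi m
    by_cases h1 : m ≡ i [ZMOD k]
    · exact Or.inl ⟨p1 h1, h1⟩
    · by_cases h2 : m ≡ i + 1 [ZMOD k]
      · exact Or.inr (Or.inl (p2 h2))
      · exact Or.inr (Or.inr (p3 h1 h2))
  have hsa : s a = a + 1 ∧ a ≡ i [ZMOD k] ∧ b = a + 1 ∧ s b = a := by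
    rcases hcases a with ⟨h1, h2⟩ | h1 | h1 <;> rcases hcases b with ⟨h3, h4⟩ | h3 | h3
    all_goals first | (exfalso; omega) | skip
    · exact ⟨h1, h2, by omega, by omega⟩
  obtain ⟨h1, h2, h3, h4⟩ := hsa
  refine ⟨hper, by rw [h1, h3], h4, fun m hma hmb => (hi m).2.2 ?_ ?_⟩
  · intro h5; exact hma (Int.ModEq.dvd (h2.trans h5.symm))
  · intro h5
    refine hmb ?_
    rw [h3]
    exact Int.ModEq.dvd ((h2.add_right 1).trans h5.symm)

/-- The simple reflection exchanging `i + kq` and `i + 1 + kq`. -/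
def affineSimpleAt (k : ℕ) (hk : 2 ≤ k) (i : ℤ) : Equiv.Perm ℤ :=
  Function.Involutive.toPerm
    (fun m => if (k : ℤ) ∣ m - i then m + 1 else if (k : ℤ) ∣ m - i - 1 then m - 1 else m) (by
      intro m
      have h1 : ∀ x : ℤ, (k : ℤ) ∣ x → ¬ (k : ℤ) ∣ x + 1 := fun x hx h => by
        have := (Int.dvd_add_right hx).1 h
        have := Int.le_of_dvd one_pos this
        omega
      by_cases hm : (k : ℤ) ∣ m - i
      · have h2 : ¬ (k : ℤ) ∣ m + 1 - i := by
          have := h1 _ hm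
          rwa [show m + 1 - i = m - i + 1 by ring]
        have h3 : (k : ℤ) ∣ m + 1 - i - 1 := by
          rwa [show m + 1 - i - 1 = m - i by ring]
        simp only [hm, if_true, h2, h3, if_false]; ring
      · by_cases hm' : (k : ℤ) ∣ m - i - 1
        · have h3 : (k : ℤ) ∣ m - 1 - i := by
            rwa [show m - 1 - i = m - i - 1 by ring]
          simp only [hm, if_true, h3, if_false, hm']; ring
        · simp only [hm, hm', if_false])

theorem affineSimpleAt_apply {k : ℕ} (hk : 2 ≤ k) (i m : ℤ) : affineSimpleAt k hk i m =
    if (k : ℤ) ∣ m - i then m + 1 else if (k : ℤ) ∣ m - i - 1 then m - 1 else m := rfl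

theorem affineSimpleAt_mem {k : ℕ} (hk : 2 ≤ k) (i : ℤ) : affineSimpleAt k hk i ∈ affineSimple k := by
  refine ⟨i, fun m => ⟨fun h => ?_, fun h => ?_, fun h h' => ?_⟩⟩
  · rw [affineSimpleAt_apply, if_pos h.symm.dvd]
  · have h1 : (k : ℤ) ∣ m - (i + 1) := h.symm.dvd
    rw [affineSimpleAt_apply, if_neg, if_pos]
    · rwa [show m - i - 1 = m - (i + 1) by ring]
    · intro h2
      have := Int.le_of_dvd one_pos
        (show (k : ℤ) ∣ 1 by simpa [show m - i - (m - (i + 1)) = 1 by ring] using dvd_sub h2 h1)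
      omega
  · rw [affineSimpleAt_apply, if_neg, if_neg]
    · intro h2; exact h' (Int.modEq_iff_dvd.2 (by rwa [show m - (i + 1) = m - i - 1 by ring])).symm
    · intro h2; exact h (Int.modEq_iff_dvd.2 h2).symm

theorem affineSimpleAt_isAffineReflection {k : ℕ} (hk : 2 ≤ k) (i : ℤ) :
    IsAffineReflection k i (i + 1) (affineSimpleAt k hk i) := by
  refine affineSimple_isAffineReflection (affineSimpleAt_mem hk i) (by omega) ?_
  have : ¬ (k : ℤ) ∣ 1 := fun h => by have := Int.le_of_dvd one_pos h; omega
  simp [affineSimpleAt_apply, this]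

/-! ### Generation by descents -/

theorem sum_window_simple {k : ℕ} (hk : 2 ≤ k) (i : ℤ) (F : ℤ → ℤ → ℤ) (w : Equiv.Perm ℤ) :
    ∑ j ∈ Finset.range k, F ((w * affineSimpleAt k hk i) (i + j)) (i + j) =
      ∑ j ∈ Finset.range k, F (w (i + j)) (i + j) +
        (F (w (i + 1)) i + F (w i) (i + 1) - F (w i) i - F (w (i + 1)) (i + 1)) := by
  obtain ⟨l, rfl⟩ : ∃ l, k = l + 2 := ⟨k - 2, by omega⟩
  -- In the window starting at i only the first two positions are affected. The function F is kept
  -- general because it is used both for the linear sum condition and for the quadratic descent.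
  have hr := affineSimpleAt_isAffineReflection hk i
  rw [Finset.sum_range_succ', Finset.sum_range_succ', Finset.sum_range_succ' _ (l + 1),
    Finset.sum_range_succ' _ l]
  have : ∀ j ∈ Finset.range l,
      F ((w * affineSimpleAt (l + 2) hk i) (i + ((j + 1 + 1 : ℕ) : ℤ))) (i + ((j + 1 + 1 : ℕ) : ℤ))
      = F (w (i + ((j + 1 + 1 : ℕ) : ℤ))) (i + ((j + 1 + 1 : ℕ) : ℤ)) := by
    intro j hj
    rw [Finset.mem_range] at hj
    rw [Equiv.Perm.mul_apply, hr.2.2.2]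
    · intro h
      have := Int.le_of_dvd (by omega) h
      push_cast at this; omega
    · intro h
      have := Int.le_of_dvd (by omega) h
      push_cast at this; omega
  rw [Finset.sum_congr rfl this]
  have e1 : affineSimpleAt (l + 2) hk i i = i + 1 := hr.2.1
  have e2 : affineSimpleAt (l + 2) hk i (i + 1) = i := hr.2.2.1
  simp only [Equiv.Perm.mul_apply, zero_add, Nat.cast_one, Nat.cast_zero, add_zero, e1, e2]
  ring

theorem mul_affineSimpleAt_mem {k : ℕ} (hk : 2 ≤ k) (i : ℤ) {w : Equiv.Perm ℤ}
    (hw : w ∈ affineSymm k) : w * affineSimpleAt k hk i ∈ affineSymm k := by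
  have hper : ∀ m : ℤ, (w * affineSimpleAt k hk i) (m + k) = (w * affineSimpleAt k hk i) m + k := by
    intro m
    simp only [Equiv.Perm.mul_apply, affineSimple_period (affineSimpleAt_mem hk i), hw.1]
  rw [mem_affineSymm_iff hper i, sum_window_simple hk i (fun x y => x - y) w,
    (mem_affineSymm_iff hw.1 i).1 hw]
  ring

theorem eq_add_of_strictMono {u : Equiv.Perm ℤ} (hu : StrictMono u) (x : ℤ) : u x = x + u 0 := by
  have hstep : ∀ x, u (x + 1) = u x + 1 := by
    intro x
    have h1 : u x < u (x + 1) := hu (by omega)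
    obtain ⟨y, hy⟩ := u.surjective (u x + 1)
    have h2 : x < y := hu.lt_iff_lt.1 (by omega)
    have h3 : u (x + 1) ≤ u y := hu.monotone (by omega)
    omega
  have := apply_add_mul_of_quasiperiodic hstep 0 x
  simpa [add_comm] using this

theorem affineSymm_eq_one_of_strictMono {k : ℕ} [NeZero k] {u : Equiv.Perm ℤ}
    (h : u ∈ affineSymm k) (hu : StrictMono u) : u = 1 := by
  have h1 := (mem_affineSymm_iff h.1 0).1 h
  have h2 : ∀ x, u x - x = u 0 := fun x => by rw [eq_add_of_strictMono hu x]; ring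
  simp only [h2, Finset.sum_const, Finset.card_range, nsmul_eq_mul, mul_eq_zero, Nat.cast_eq_zero,
    NeZero.ne k, false_or] at h1
  ext x
  rw [eq_add_of_strictMono hu x, h1]; simp

/-- A w that is not increasing has a descent w(i+1) < w(i), and right multiplication by σ_i lowers
the sum of (w(m) - m)² over a period by 2(w(i) - w(i+1)) > 0. Strong induction on this sum ends at
an increasing element, which is the identity. -/
theorem affineSymm_induction {k : ℕ} [NeZero k] {P : Equiv.Perm ℤ → Prop} (h1 : P 1)
    (hs : ∀ w, ∀ (hk : 2 ≤ k) (i : ℤ), P (w * affineSimpleAt k hk i) → P w)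
    (w : Equiv.Perm ℤ) (hw : w ∈ affineSymm k) : P w := by
  obtain ⟨N, hN⟩ : ∃ N : ℕ, (∑ m ∈ Finset.Icc (1 : ℤ) k, (w m - m) ^ 2).toNat = N := ⟨_, rfl⟩
  induction N using Nat.strong_induction_on generalizing w with
  | _ N ih =>
    by_cases hmono : ∀ i, w i < w (i + 1)
    · rw [affineSymm_eq_one_of_strictMono hw (strictMono_int_of_lt_succ hmono)]; exact h1
    · push Not at hmono
      obtain ⟨i, hi⟩ := hmono
      have hlt : w (i + 1) < w i := lt_of_le_of_ne hi fun h => by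
        have := w.injective h; omega
      -- For k = 1 periodicity reads w(i+1) = w(i) + 1, so there is no descent.
      have hk : 2 ≤ k := by
        by_contra hcon
        have hk1 : k = 1 := by have := NeZero.ne k; omega
        have := hw.1 i
        rw [hk1, Nat.cast_one] at this
        omega
      refine hs w hk i (ih _ ?_ _ (mul_affineSimpleAt_mem hk i hw) rfl)
      have hmem := mul_affineSimpleAt_mem hk i hw
      rw [← hN, ← sum_range_add_eq_of_periodic
        (p := fun m => ((w * affineSimpleAt k hk i) m - m) ^ 2) (fun m => by rw [hmem.1]; ring) i,
        ← sum_range_add_eq_of_periodic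
        (p := fun m => (w m - m) ^ 2) (fun m => by rw [hw.1]; ring) i,
        sum_window_simple hk i (fun x y => (x - y) ^ 2) w]
      have h0 : 0 ≤ ∑ j ∈ Finset.range k, (w (i + j) - (i + j)) ^ 2 :=
        Finset.sum_nonneg fun _ _ => sq_nonneg _
      have h0' : 0 ≤ ∑ j ∈ Finset.range k, ((w * affineSimpleAt k hk i) (i + j) - (i + j)) ^ 2 :=
        Finset.sum_nonneg fun _ _ => sq_nonneg _
      rw [sum_window_simple hk i (fun x y => (x - y) ^ 2) w] at h0'
      have hneg : (w (i + 1) - i) ^ 2 + (w i - (i + 1)) ^ 2 - (w i - i) ^ 2 -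
          (w (i + 1) - (i + 1)) ^ 2 < 0 := by nlinarith
      omega

theorem affineSimple_generate {k : ℕ} [NeZero k] (w : Equiv.Perm ℤ) (hw : w ∈ affineSymm k) :
    ∃ L : List (Equiv.Perm ℤ), (∀ s ∈ L, s ∈ affineSimple k) ∧ L.prod = w := by
  refine affineSymm_induction (k := k) (P := fun w => ∃ L : List (Equiv.Perm ℤ),
    (∀ s ∈ L, s ∈ affineSimple k) ∧ L.prod = w) ⟨[], by simp, rfl⟩ ?_ w hw
  rintro w hk i ⟨L, hL, hp⟩
  refine ⟨L ++ [affineSimpleAt k hk i], ?_, ?_⟩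
  · intro s hs
    rcases List.mem_append.1 hs with h | h
    · exact hL s h
    · rw [List.mem_singleton.1 h]; exact affineSimpleAt_mem hk i
  · rw [List.prod_append, hp, List.prod_singleton, mul_assoc,
      affineSimple_mul_self (affineSimpleAt_mem hk i), mul_one]

theorem affineSymm_mul_mem {k : ℕ} [NeZero k] {v w : Equiv.Perm ℤ} (hv : v ∈ affineSymm k)
    (hw : w ∈ affineSymm k) : v * w ∈ affineSymm k := by
  refine affineSymm_induction (k := k) (P := fun w => v * w ∈ affineSymm k) (by simpa using hv)
    (fun w hk i h => ?_) w hw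
  have := mul_affineSimpleAt_mem hk i h
  rwa [mul_assoc, mul_assoc, affineSimple_mul_self (affineSimpleAt_mem hk i), mul_one] at this

/-! ### Extended weights -/

theorem weightExt_add_period {k : ℕ} [NeZero k] (n : ℕ) (mu : Fin k → ℕ) (m : ℤ) :
    weightExt n mu (m + k) = weightExt n mu m - n := by
  have hk : (k : ℤ) ≠ 0 := by exact_mod_cast NeZero.ne k
  have e1 : (m + k - 1) % (k : ℤ) = (m - 1) % k := by
    rw [show m + k - 1 = m - 1 + k by ring, Int.add_emod_right]
  have e2 : (m + k - 1) / (k : ℤ) = (m - 1) / k + 1 := by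
    rw [show m + k - 1 = m - 1 + k by ring, Int.add_ediv_of_dvd_right dvd_rfl, Int.ediv_self hk]
  simp only [weightExt, e1, e2]
  ring

theorem weightExt_apply {k : ℕ} [NeZero k] (n : ℕ) (mu : Fin k → ℕ) (i : Fin k) (q : ℤ) :
    weightExt n mu (1 + i + k * q) = mu i - n * q := by
  have h := apply_add_mul_of_quasiperiodic (f := weightExt n mu) (k := k) (c := -n)
    (fun m => by rw [weightExt_add_period]; ring) (1 + i) q
  rw [h]
  have e1 : (1 + (i : ℤ) - 1) % (k : ℤ) = i := by
    rw [add_sub_cancel_left]; exact Int.emod_eq_of_lt (by positivity) (by exact_mod_cast i.2)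
  have e2 : (1 + (i : ℤ) - 1) / (k : ℤ) = 0 := by
    rw [add_sub_cancel_left]; exact Int.ediv_eq_zero_of_lt (by positivity) (by exact_mod_cast i.2)
  simp only [weightExt, e1, e2, Int.toNat_natCast]
  ring

theorem exists_eq_add_mul {k : ℕ} [NeZero k] (a m : ℤ) : ∃ (i : Fin k) (q : ℤ), m = a + i + k * q := by
  have hk : (0 : ℤ) < k := by exact_mod_cast Nat.pos_of_ne_zero (NeZero.ne k)
  have h1 := Int.emod_nonneg (m - a) hk.ne'
  have h2 := Int.emod_lt_of_pos (m - a) hk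
  refine ⟨⟨((m - a) % k).toNat, by omega⟩, (m - a) / k, ?_⟩
  have := Int.emod_add_mul_ediv (m - a) k
  simp only
  rw [Int.toNat_of_nonneg h1]
  linarith

theorem weightExt_antitone {k n : ℕ} [NeZero k] {mu : Fin k → ℕ} (hmu : mu ∈ alcove k n) :
    Antitone (weightExt n mu) := by
  refine antitone_int_of_succ_le fun m => ?_
  obtain ⟨i, q, rfl⟩ := exists_eq_add_mul (k := k) 1 m
  by_cases hi : (i : ℕ) + 1 < k
  · have := weightExt_apply n mu ⟨i + 1, hi⟩ q
    rw [weightExt_apply]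
    rw [show 1 + (i : ℤ) + k * q + 1 = 1 + ((⟨i + 1, hi⟩ : Fin k) : ℕ) + k * q by push_cast; ring,
      this]
    have h : mu ⟨i + 1, hi⟩ ≤ mu i := hmu.1 (by rw [Fin.le_def]; simp)
    have : (mu ⟨i + 1, hi⟩ : ℤ) ≤ mu i := by exact_mod_cast h
    linarith
  · have hi' : (i : ℤ) + 1 = k := by have := i.2; omega
    have := weightExt_apply n mu 0 (q + 1)
    rw [weightExt_apply, show 1 + (i : ℤ) + k * q + 1 = 1 + ((0 : Fin k) : ℕ) + k * (q + 1) by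
      simp; linarith, this]
    -- At the end of a period the alcove bounds enter: μ_{k+1} = μ_1 - n ≤ 0 < 1 ≤ μ_k.
    have h1 : (mu 0 : ℤ) ≤ n := by exact_mod_cast (hmu.2 0).2
    have h2 : (1 : ℤ) ≤ mu i := by exact_mod_cast (hmu.2 i).1
    linarith

theorem exists_mem_affineReps {k : ℕ} [NeZero k] (n : ℕ) (mu : Fin k → ℕ) {g : Equiv.Perm ℤ}
    (hg : g ∈ affineSymm k) :
    ∃ w ∈ affineReps n mu, weightExt n mu ∘ w = weightExt n mu ∘ g := by
  obtain ⟨h, hh, hw⟩ := exists_minCosetRep (affineSimple k) (affineSymm k)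
    {s | s ∈ affineSymm k ∧ weightExt n mu ∘ s = weightExt n mu}
    (fun _ ha _ hb => affineSymm_mul_mem ha.1 hb) ⟨⟨fun _ => rfl, rfl⟩, rfl⟩
    (fun a ha b hb => ⟨affineSymm_mul_mem ha.1 hb.1, by
      change weightExt n mu ∘ (a ∘ b) = _
      rw [← Function.comp_assoc, ha.2, hb.2]⟩) hg
  refine ⟨h * g, hw, ?_⟩
  change weightExt n mu ∘ (h ∘ g) = _
  rw [← Function.comp_assoc, hh.2]

theorem affineReps_injOn {k n : ℕ} [NeZero k] [NeZero n] {mu : Fin k → ℕ} (hmu : mu ∈ alcove k n)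
    {w w' : Equiv.Perm ℤ} (hw : w ∈ affineReps n mu) (hw' : w' ∈ affineReps n mu)
    (h : weightExt n mu ∘ w = weightExt n mu ∘ w') : w = w' := by
  have hanti := weightExt_antitone hmu
  have key : ∀ v ∈ affineReps n mu, ∀ a b, a < b → weightExt n mu a = weightExt n mu b →
      v⁻¹ a < v⁻¹ b := by
    intro v hv
    refine lt_of_lt_succ_of_antitone hanti fun a ha he => ?_
    rw [Order.succ_eq_add_one] at he ⊢
    have hk : 2 ≤ k := by
      by_contra hcon
      have hk1 : k = 1 := by have := NeZero.ne k; omega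
      have h1 := weightExt_add_period n mu a
      have h2 : (n : ℤ) ≠ 0 := by exact_mod_cast NeZero.ne n
      have h3 : a + (k : ℤ) = a + 1 := by rw [hk1]; simp
      rw [h3] at h1
      omega
    have hr := affineSimpleAt_isAffineReflection hk a
    refine minCosetReps_inv_lt_inv (R := IsAffineReflection k)
      (fun s hs a b => affineSimple_isAffineReflection hs) (fun s hs => affineSimple_mul_self hs)
      (fun t ht a b s h => h.conj (affineSimple_period ht)) (fun a b s s' h h' => h.unique h')
      affineSimple_generate hv (by omega) hr ⟨?_, ?_⟩
    · simpa using mul_affineSimpleAt_mem hk a (w := 1) ⟨fun _ => rfl, rfl⟩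
    · funext x
      have hp := apply_add_mul_of_quasiperiodic (f := weightExt n mu) (k := k) (c := -n)
        (fun m => by rw [weightExt_add_period]; ring)
      simp only [Function.comp_apply]
      by_cases h1 : (k : ℤ) ∣ x - a
      · obtain ⟨q, hq⟩ := h1
        rw [hr.apply_of_dvd ⟨q, hq⟩, hq, show x = a + k * q by linarith, hp, he, ← hp]
        ring_nf
      · by_cases h2 : (k : ℤ) ∣ x - (a + 1)
        · obtain ⟨q, hq⟩ := h2
          rw [hr.apply_of_dvd' ⟨q, hq⟩, hq, show x = a + 1 + k * q by linarith, hp, ← he, ← hp]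
          ring_nf
        · rw [hr.2.2.2 x h1 h2]
  have hmono := strictMono_mul_inv_of_comp_eq hanti h (key w hw) (key w' hw')
  -- The quotient is translation by some c and preserves the extended weight. Iterated k times it
  -- translates by ck, which changes the weight by -nc; hence c = 0.
  have hadd := eq_add_of_strictMono hmono
  have hu : ∀ x, weightExt n mu ((w' * w⁻¹) x) = weightExt n mu x := fun x => by
    have := congrFun h (w⁻¹ x)
    simpa using this.symm
  set c := (w' * w⁻¹) 0
  have hc : ∀ j : ℕ, weightExt n mu (0 + c * j) = weightExt n mu 0 := by
    intro j
    induction j with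
    | zero => simp
    | succ j ih =>
      rw [← ih, ← hu (0 + c * j), hadd]
      push_cast; ring_nf
  have h0 := hc k
  rw [mul_comm, apply_add_mul_of_quasiperiodic (f := weightExt n mu) (k := k) (c := -n)
        (fun m => by rw [weightExt_add_period]; ring) 0 c] at h0
  have hc0 : c = 0 := by
    have h2 : (n : ℤ) ≠ 0 := by exact_mod_cast NeZero.ne n
    have h3 : (n : ℤ) * c = 0 := by linarith
    exact (mul_eq_zero.1 h3).resolve_left h2
  have h1 : w' * w⁻¹ = 1 := by
    ext x
    rw [hadd, hc0]; simp
  exact (mul_inv_eq_one.1 h1).symm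

/-! ### The combinatorial weight `θ` -/

/-- `c` is congruent modulo `n` to a rearrangement of `mu`. -/
def CongrOrbit {k : ℕ} (n : ℕ) (c : Fin k → ℤ) (mu : Fin k → ℕ) : Prop :=
  ∃ σ : Equiv.Perm (Fin k), ∀ i, (n : ℤ) ∣ c i - mu (σ i)

/-! ### Affine permutations in window coordinates -/

theorem affineSymm_exists_window {k : ℕ} [NeZero k] {w : Equiv.Perm ℤ} (hw : w ∈ affineSymm k)
    (a b : ℤ) : ∃ (σ : Equiv.Perm (Fin k)) (β : Fin k → ℤ),
      (∀ j : Fin k, w (a + j) = b + σ j + k * β j) ∧ ∑ j, β j = a - b := by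
  have hk : (k : ℤ) ≠ 0 := by exact_mod_cast NeZero.ne k
  choose s β h using fun j : Fin k => exists_eq_add_mul (k := k) b (w (a + j))
  have hinj : Function.Injective s := by
    intro j j' hjj
    have h1 : w (a + j) = w (a + j' + k * (β j - β j')) := by
      rw [apply_add_mul_of_quasiperiodic hw.1, h j, h j', hjj]; ring
    have h2 : (j : ℤ) - j' = k * (β j - β j') := by linarith [w.injective h1]
    have h3 : (k : ℤ) ∣ (j : ℤ) - j' := ⟨_, h2⟩
    have h4 : (j : ℤ) - j' = 0 := by
      refine Int.eq_zero_of_abs_lt_dvd h3 ?_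
      rw [abs_lt]; have := j.2; have := j'.2; constructor <;> omega
    exact Fin.ext (by omega)
  have hbij : Function.Bijective s := Finite.injective_iff_bijective.1 hinj
  refine ⟨Equiv.ofBijective s hbij, β, h, ?_⟩
  have hsum := (mem_affineSymm_iff hw.1 a).1 hw
  rw [← Fin.sum_univ_eq_sum_range (fun j : ℕ => w (a + j) - (a + j)) k] at hsum
  simp only [h] at hsum
  have hperm : ∑ j, ((s j : ℕ) : ℤ) = ∑ j : Fin k, ((j : ℕ) : ℤ) :=
    Equiv.sum_comp (Equiv.ofBijective s hbij) (fun j : Fin k => ((j : ℕ) : ℤ))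
  simp only [Finset.sum_sub_distrib, Finset.sum_add_distrib, Finset.sum_const, Finset.card_univ,
    Fintype.card_fin, ← Finset.mul_sum, hperm, nsmul_eq_mul] at hsum
  have : (k : ℤ) * (∑ j, β j - (a - b)) = 0 := by linarith
  have := (mul_eq_zero.1 this).resolve_left hk
  linarith

theorem bijective_window {k : ℕ} [NeZero k] (a : ℤ) :
    Function.Bijective (fun p : Fin k × ℤ => a + (p.1 : ℤ) + k * p.2) := by
  constructor
  · rintro ⟨j, q⟩ ⟨j', q'⟩ h
    simp only at h
    have h2 : (j : ℤ) - j' = k * (q' - q) := by linarith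
    have h4 : (j : ℤ) - j' = 0 := by
      refine Int.eq_zero_of_abs_lt_dvd ⟨_, h2⟩ ?_
      rw [abs_lt]; have := j.2; have := j'.2; constructor <;> omega
    have hk : (k : ℤ) ≠ 0 := by exact_mod_cast NeZero.ne k
    rw [h4] at h2
    have h5 := (mul_eq_zero.1 h2.symm).resolve_left hk
    exact Prod.ext (Fin.ext (by simp only; omega)) (by simp only; omega)
  · intro m
    obtain ⟨j, q, h⟩ := exists_eq_add_mul (k := k) a m
    exact ⟨(j, q), h.symm⟩

/-- Converse of `affineSymm_exists_window`: elements of the affine group are the pairs (σ, β) with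
Σβ = a - b. Two base points are needed because λ[d] takes the values λ_1, ..., λ_k on the window
starting at d + 1, while μ takes its values on the window starting at 1. -/
theorem exists_affineSymm_of_window {k : ℕ} [NeZero k] (a b : ℤ) (σ : Equiv.Perm (Fin k))
    (β : Fin k → ℤ) (hβ : ∑ j, β j = a - b) :
    ∃ w ∈ affineSymm k, ∀ j : Fin k, w (a + j) = b + σ j + k * β j := by
  let E (a : ℤ) : Fin k × ℤ ≃ ℤ := Equiv.ofBijective _ (bijective_window a)
  let T : Equiv.Perm (Fin k × ℤ) :=
    { toFun := fun p => (σ p.1, p.2 + β p.1)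
      invFun := fun p => (σ.symm p.1, p.2 - β (σ.symm p.1))
      left_inv := fun p => by simp
      right_inv := fun p => by simp }
  let w : Equiv.Perm ℤ := ((E a).symm.trans T).trans (E b)
  have hw : ∀ (j : Fin k) (q : ℤ), w (a + j + k * q) = b + σ j + k * (q + β j) := by
    intro j q
    have h1 : (E a).symm (a + j + k * q) = (j, q) := (E a).symm_apply_apply (j, q)
    simp only [w, Equiv.trans_apply, h1]
    rfl
  have hper : ∀ m : ℤ, w (m + k) = w m + k := by
    intro m
    obtain ⟨j, q, rfl⟩ := exists_eq_add_mul (k := k) a m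
    rw [show a + (j : ℤ) + k * q + k = a + j + k * (q + 1) by ring, hw, hw]; ring
  have hw0 : ∀ j : Fin k, w (a + j) = b + σ j + k * β j := fun j => by simpa using hw j 0
  refine ⟨w, (mem_affineSymm_iff hper a).2 ?_, hw0⟩
  rw [← Fin.sum_univ_eq_sum_range (fun j : ℕ => w (a + j) - (a + j)) k]
  simp only [hw0]
  have hperm : ∑ j, ((σ j : ℕ) : ℤ) = ∑ j : Fin k, ((j : ℕ) : ℤ) :=
    Equiv.sum_comp σ (fun j : Fin k => ((j : ℕ) : ℤ))
  simp only [Finset.sum_sub_distrib, Finset.sum_add_distrib, Finset.sum_const, Finset.card_univ,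
    Fintype.card_fin, ← Finset.mul_sum, hperm, nsmul_eq_mul, hβ]
  ring

theorem cylLoop_window {k : ℕ} [NeZero k] (n : ℕ) (lam : Fin k → ℕ) (d : ℤ) (j : Fin k) (q : ℤ) :
    cylLoop n lam d (d + 1 + j + k * q) = lam j - n * q := by
  rw [cylLoop, ← weightExt_apply]; congr 1; ring

theorem cylLoop_add_period {k : ℕ} [NeZero k] (n : ℕ) (lam : Fin k → ℕ) (d m : ℤ) :
    cylLoop n lam d (m + k) = cylLoop n lam d m - n := by
  rw [cylLoop, cylLoop, ← weightExt_add_period]; congr 1; ring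

theorem comp_le_cylLoop_iff {k n : ℕ} [NeZero k] {lam mu : Fin k → ℕ} {d : ℤ} {w : Equiv.Perm ℤ}
    (hw : w ∈ affineSymm k) : (∀ i, weightExt n mu (w i) ≤ cylLoop n lam d i) ↔
      ∀ j : Fin k, weightExt n mu (w (d + 1 + j)) ≤ lam j := by
  have hq : ∀ (m q : ℤ), weightExt n mu (w (m + k * q)) = weightExt n mu (w m) - n * q := by
    intro m q
    rw [apply_add_mul_of_quasiperiodic hw.1, apply_add_mul_of_quasiperiodic
      (f := weightExt n mu) (k := k) (c := -n) (fun m => by rw [weightExt_add_period]; ring)]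
    ring
  constructor
  · intro h j
    have := h (d + 1 + j + k * 0)
    rw [cylLoop_window] at this
    simpa using this
  · intro h i
    obtain ⟨j, q, rfl⟩ := exists_eq_add_mul (k := k) (d + 1) i
    rw [cylLoop_window, hq]
    linarith [h j]

/-- The bijection sends w to g = λ - μ ∘ w read on the window at d + 1. In coordinates g_j = λ_j -
μ_{σ(j)} + nβ_j, and the normalisation Σβ = d is exactly the size condition on g. -/
theorem cylTheta_eq_ncard {k n : ℕ} [NeZero k] [NeZero n] (lam : Fin k → ℕ) (d : ℤ)
    {mu : Fin k → ℕ} (hmu : mu ∈ alcove k n) :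
    cylTheta n lam d mu = Set.ncard {g : Fin k → ℕ |
      (∑ i, (g i : ℤ)) = weightSize lam + d * n - weightSize mu ∧
        CongrOrbit n (fun i => (lam i : ℤ) - g i) mu} := by
  let F : Equiv.Perm ℤ → Fin k → ℕ := fun w j => (lam j - weightExt n mu (w (d + 1 + j))).toNat
  have hF : ∀ w ∈ affineSymm k, (∀ i, weightExt n mu (w i) ≤ cylLoop n lam d i) →
      ∀ j, (F w j : ℤ) = lam j - weightExt n mu (w (d + 1 + j)) := by
    intro w hw hle j
    exact Int.toNat_of_nonneg (by linarith [(comp_le_cylLoop_iff hw).1 hle j])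
  rw [cylTheta, ← Set.InjOn.ncard_image (f := F)]
  · congr 1
    ext g
    constructor
    · rintro ⟨w, ⟨hw, hle⟩, rfl⟩
      obtain ⟨σ, β, h1, h2⟩ := affineSymm_exists_window hw.1 (d + 1) 1
      have hFw := hF w hw.1 hle
      simp only [h1, weightExt_apply] at hFw
      refine ⟨?_, σ, fun i => ⟨-β i, ?_⟩⟩
      · simp only [hFw, Finset.sum_sub_distrib, ← Finset.mul_sum, h2, weightSize]
        rw [Equiv.sum_comp σ (fun i => (mu i : ℤ))]
        push_cast; ring
      · simp only [hFw]; ring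
    · rintro ⟨hsum, σ, hσ⟩
      choose γ hγ using hσ
      have hβ : ∑ j, (-γ j) = d + 1 - 1 := by
        have h1 : ∑ i, ((lam i : ℤ) - g i - mu (σ i)) = ∑ i, (n : ℤ) * γ i :=
          Finset.sum_congr rfl fun i _ => hγ i
        rw [Finset.sum_sub_distrib, Finset.sum_sub_distrib, hsum,
          Equiv.sum_comp σ (fun i => (mu i : ℤ)), ← Finset.mul_sum] at h1
        simp only [weightSize] at h1
        push_cast at h1
        have hn : (n : ℤ) ≠ 0 := by exact_mod_cast NeZero.ne n
        have h2 : (n : ℤ) * (∑ j, γ j + d) = 0 := by linarith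
        have := (mul_eq_zero.1 h2).resolve_left hn
        rw [Finset.sum_neg_distrib]; linarith
      obtain ⟨w₀, hw₀, h1⟩ := exists_affineSymm_of_window (d + 1) 1 σ (fun j => -γ j) hβ
      -- Only μ ∘ w enters g, so the constructed element may be replaced by the minimal
      -- representative of its coset.
      obtain ⟨w, hw, hcomp⟩ := exists_mem_affineReps n mu hw₀
      have hval : ∀ j : Fin k, weightExt n mu (w (d + 1 + j)) = lam j - g j := by
        intro j
        have := congrFun hcomp (d + 1 + j)
        simp only [Function.comp_apply] at this
        rw [this, h1, weightExt_apply]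
        linarith [hγ j]
      refine ⟨w, ⟨hw, (comp_le_cylLoop_iff hw.1).2 fun j => ?_⟩, ?_⟩
      · rw [hval]; have : (0 : ℤ) ≤ g j := by positivity
        linarith
      · funext j
        simp only [F, hval]; simp
  · rintro w ⟨hw, hle⟩ w' ⟨hw', hle'⟩ h
    refine affineReps_injOn hmu hw hw' (funext fun m => ?_)
    obtain ⟨j, q, rfl⟩ := exists_eq_add_mul (k := k) (d + 1) m
    have h1 := hF w hw.1 hle j
    have h2 := hF w' hw'.1 hle' j
    rw [h] at h1
    simp only [Function.comp_apply]
    rw [apply_add_mul_of_quasiperiodic hw.1.1, apply_add_mul_of_quasiperiodic hw'.1.1]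
    have hp := apply_add_mul_of_quasiperiodic (f := weightExt n mu) (k := k) (c := -n)
      (fun m => by rw [weightExt_add_period]; ring)
    rw [hp, hp]
    linarith

/-- Some element of i, ..., i + k - 1 is sent by w to an integer ≤ i: measured against the window at
i + 1 the translations β sum to -1, so one of them is negative. Antitonicity of both loops then
moves the inequality back to i. -/
theorem cylLoop_le_of_comp_le {k n : ℕ} [NeZero k] {lam mu : Fin k → ℕ} (hlam : lam ∈ alcove k n)
    (hmu : mu ∈ alcove k n) {d : ℤ} {w : Equiv.Perm ℤ} (hw : w ∈ affineSymm k)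
    (hle : ∀ i, weightExt n mu (w i) ≤ cylLoop n lam d i) (i : ℤ) :
    cylLoop n mu 0 i ≤ cylLoop n lam d i := by
  obtain ⟨σ, β, h1, h2⟩ := affineSymm_exists_window hw i (i + 1)
  obtain ⟨j, hj⟩ : ∃ j, β j < 0 := by
    by_contra hcon
    push Not at hcon
    have := Finset.sum_nonneg (s := Finset.univ) fun j _ => hcon j
    omega
  have h3 : w (i + j) ≤ i := by
    rw [h1 j]
    have h4 : (k : ℤ) * β j ≤ k * (-1) := by
      apply mul_le_mul_of_nonneg_left (by omega) (by positivity)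
    have := (σ j).2
    omega
  calc cylLoop n mu 0 i = weightExt n mu i := by simp [cylLoop]
    _ ≤ weightExt n mu (w (i + j)) := weightExt_antitone hmu h3
    _ ≤ cylLoop n lam d (i + j) := hle _
    _ ≤ cylLoop n lam d i := weightExt_antitone hlam (by omega)

theorem cylLoop_le_of_cylTheta_ne_zero {k n : ℕ} [NeZero k] {lam mu : Fin k → ℕ}
    (hlam : lam ∈ alcove k n) (hmu : mu ∈ alcove k n) {d : ℤ} (h : cylTheta n lam d mu ≠ 0) (i : ℤ) :
    cylLoop n mu 0 i ≤ cylLoop n lam d i := by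
  obtain ⟨w, hw, hle⟩ := Set.nonempty_of_ncard_ne_zero h
  exact cylLoop_le_of_comp_le hlam hmu hw.1 hle i

/-! ### Sizes of cylindric shapes and degrees -/

theorem sum_cylLoop_sub {k : ℕ} [NeZero k] (n : ℕ) (lam mu : Fin k → ℕ) (d : ℤ) :
    ∑ m ∈ Finset.Icc (1 : ℤ) k, (cylLoop n lam d m - cylLoop n mu 0 m) =
      weightSize lam + d * n - weightSize mu := by
  rw [← sum_range_add_eq_of_periodic (p := fun m => cylLoop n lam d m - cylLoop n mu 0 m)
    (fun m => by rw [cylLoop_add_period, cylLoop_add_period]; ring) (d + 1),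
    ← Fin.sum_univ_eq_sum_range
      (fun j : ℕ => cylLoop n lam d (d + 1 + j) - cylLoop n mu 0 (d + 1 + j)) k]
  obtain ⟨σ, β, h1, h2⟩ := affineSymm_exists_window (k := k) (w := 1) ⟨fun _ => rfl, rfl⟩ (d + 1) 1
  have h3 : ∀ j : Fin k, cylLoop n mu 0 (d + 1 + j) = mu (σ j) - n * β j := by
    intro j
    have := h1 j
    rw [Equiv.Perm.one_apply] at this
    rw [cylLoop, sub_zero, this, weightExt_apply]
  have h4 : ∀ j : Fin k, cylLoop n lam d (d + 1 + j) = lam j := fun j => by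
    simpa using cylLoop_window n lam d j 0
  simp only [h3, h4, Finset.sum_sub_distrib, ← Finset.mul_sum, h2, weightSize,
    Equiv.sum_comp σ (fun i => (mu i : ℤ))]
  push_cast; ring

theorem ncard_cylShape {k : ℕ} [NeZero k] {n : ℕ} {lam mu : Fin k → ℕ} {d : ℤ}
    (h : ∀ i, cylLoop n mu 0 i ≤ cylLoop n lam d i) :
    (Set.ncard {q : ℤ × ℤ | q ∈ cylShape n lam d mu ∧ 1 ≤ q.1 ∧ q.1 ≤ k} : ℤ) =
      weightSize lam + d * n - weightSize mu := by
  have hset : {q : ℤ × ℤ | q ∈ cylShape n lam d mu ∧ 1 ≤ q.1 ∧ q.1 ≤ k} =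
      ((((Finset.Icc (1 : ℤ) k).sigma fun a =>
        Finset.Ioc (cylLoop n mu 0 a) (cylLoop n lam d a)).map
          (Equiv.sigmaEquivProd ℤ ℤ).toEmbedding : Finset (ℤ × ℤ)) : Set (ℤ × ℤ)) := by
    ext ⟨a, b⟩
    simp only [cylShape, Set.mem_ofPred_eq, Finset.coe_map, Set.mem_image, Finset.mem_coe,
      Finset.mem_sigma, Finset.mem_Icc, Finset.mem_Ioc]
    constructor
    · rintro ⟨h1, h2⟩
      exact ⟨⟨a, b⟩, ⟨h2, h1⟩, rfl⟩
    · rintro ⟨⟨a', b'⟩, ⟨h1, h2⟩, h3⟩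
      simp only [Equiv.coe_toEmbedding, Equiv.sigmaEquivProd_apply, Prod.mk.injEq] at h3
      obtain ⟨rfl, rfl⟩ := h3
      exact ⟨h2, h1⟩
  rw [hset, Set.ncard_coe_finset, Finset.card_map, Finset.card_sigma, ← sum_cylLoop_sub]
  push_cast
  refine Finset.sum_congr rfl fun a _ => ?_
  rw [Int.card_Ioc, Int.toNat_of_nonneg (by linarith [h a])]

theorem one_le_weightExt_iff {k n : ℕ} [NeZero k] {mu : Fin k → ℕ} (hmu : mu ∈ alcove k n) (i : ℤ) :
    1 ≤ weightExt n mu i ↔ i ≤ k := by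
  have hk : 0 < k := Nat.pos_of_ne_zero (NeZero.ne k)
  have h1 : (1 : ℤ) ≤ weightExt n mu k := by
    have := weightExt_apply n mu ⟨k - 1, by omega⟩ 0
    rw [show (1 : ℤ) + ((⟨k - 1, by omega⟩ : Fin k) : ℕ) + k * 0 = k by
      rw [mul_zero, add_zero, Nat.cast_sub hk]; ring] at this
    rw [this]
    have := (hmu.2 ⟨k - 1, by omega⟩).1
    simpa using this
  have h2 : weightExt n mu (k + 1) ≤ 0 := by
    have := weightExt_apply n mu 0 1
    rw [show (1 : ℤ) + ((0 : Fin k) : ℕ) + k * 1 = k + 1 by simp; ring] at this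
    rw [this]
    have := (hmu.2 0).2
    have : (mu 0 : ℤ) ≤ n := by exact_mod_cast this
    linarith
  have hanti := weightExt_antitone hmu
  constructor
  · intro h
    by_contra hcon
    have := hanti (show (k : ℤ) + 1 ≤ i by omega)
    linarith
  · intro h
    exact h1.trans (hanti h)

/-- Equal sizes turn the inequality of loops into an equality. A loop λ[d] is positive exactly up to
index k + d, which recovers d and then the weight. -/
theorem eq_of_cylLoop_le_of_size_eq {k n : ℕ} [NeZero k] {lam mu : Fin k → ℕ}
    (hlam : lam ∈ alcove k n) (hmu : mu ∈ alcove k n) {d : ℤ}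
    (h : ∀ i, cylLoop n mu 0 i ≤ cylLoop n lam d i)
    (hsize : (weightSize lam + d * n : ℤ) = weightSize mu) : mu = lam ∧ d = 0 := by
  have hsum := sum_cylLoop_sub n lam mu d
  rw [hsize, sub_self, Finset.sum_eq_zero_iff_of_nonneg fun m _ => by linarith [h m]] at hsum
  have heq : ∀ i, weightExt n mu i = cylLoop n lam d i := by
    intro i
    obtain ⟨j, q, rfl⟩ := exists_eq_add_mul (k := k) 1 i
    have h1 := hsum (1 + j) (by simp only [Finset.mem_Icc]; have := j.2; omega)
    have hp := apply_add_mul_of_quasiperiodic (f := weightExt n mu) (k := k) (c := -n)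
      (fun m => by rw [weightExt_add_period]; ring)
    have hp' := apply_add_mul_of_quasiperiodic (f := cylLoop n lam d) (k := k) (c := -n)
      (fun m => by rw [cylLoop_add_period]; ring)
    rw [hp, hp']
    rw [cylLoop, cylLoop, sub_zero] at h1
    rw [cylLoop]; linarith
  have hiff : ∀ i : ℤ, i ≤ k ↔ i - d ≤ k := fun i => by
    rw [← one_le_weightExt_iff hmu, heq, cylLoop, one_le_weightExt_iff hlam]
  have hd : d = 0 := by
    have h1 := (hiff k).1 le_rfl
    have h2 := (hiff (k + d)).2 (by omega)
    omega
  refine ⟨funext fun j => ?_, hd⟩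
  have h1 := heq (1 + j + k * 0)
  rw [hd, cylLoop, sub_zero, weightExt_apply, weightExt_apply] at h1
  simpa using h1

/-- Each λ_i - g_i - μ_{σ(i)} is a multiple of n and is at most n - 1, hence is nonpositive; D is
minus the sum of the quotients. Its nonnegativity is what later makes the degrees of a path weakly
increase. -/
theorem CongrOrbit.exists_degree {k n : ℕ} [NeZero n] {lam mu : Fin k → ℕ} (hlam : lam ∈ alcove k n)
    (hmu : mu ∈ alcove k n) {g : Fin k → ℕ} (h : CongrOrbit n (fun i => (lam i : ℤ) - g i) mu) :
    ∃ D : ℕ, weightSize lam + D * n = ∑ i, g i + weightSize mu := by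
  obtain ⟨σ, hσ⟩ := h
  choose γ hγ using hσ
  have hn : (0 : ℤ) < n := by exact_mod_cast Nat.pos_of_ne_zero (NeZero.ne n)
  have hneg : ∀ i, γ i ≤ 0 := by
    intro i
    have h1 : (lam i : ℤ) ≤ n := by exact_mod_cast (hlam.2 i).2
    have h2 : (1 : ℤ) ≤ mu (σ i) := by exact_mod_cast (hmu.2 (σ i)).1
    have h3 : (0 : ℤ) ≤ g i := by positivity
    by_contra hcon
    have : (n : ℤ) * 1 ≤ n * γ i := mul_le_mul_of_nonneg_left (by omega) hn.le
    linarith [hγ i]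
  have h1 : ∑ i, ((lam i : ℤ) - g i - mu (σ i)) = ∑ i, (n : ℤ) * γ i :=
    Finset.sum_congr rfl fun i _ => hγ i
  rw [Finset.sum_sub_distrib, Finset.sum_sub_distrib,
    Equiv.sum_comp σ (fun i => (mu i : ℤ)), ← Finset.mul_sum] at h1
  have h2 : 0 ≤ -∑ i, γ i := by
    rw [← Finset.sum_neg_distrib]
    exact Finset.sum_nonneg fun i _ => by linarith [hneg i]
  refine ⟨(-∑ i, γ i).toNat, ?_⟩
  zify
  rw [Int.toNat_of_nonneg h2, weightSize, weightSize]
  push_cast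
  linarith

/-! ### Complete symmetric polynomials and power sums -/

/-- The complete symmetric polynomial of degree `r` in `k` variables, as a sum of monomials. -/
def completePoly (k r : ℕ) : MvPolynomial (Fin k) ℕ :=
  ∑ g ∈ Finset.piAntidiag Finset.univ r, MvPolynomial.monomial (Finsupp.equivFunOnFinite.symm g) 1

theorem completePoly_zero (k : ℕ) : completePoly k 0 = 1 := by
  simp only [completePoly, Finset.piAntidiag_zero, Finset.sum_singleton]
  rw [show (Finsupp.equivFunOnFinite.symm (0 : Fin k → ℕ)) = 0 by ext; simp]
  simp

theorem rename_completePoly {k : ℕ} (r : ℕ) (σ : Equiv.Perm (Fin k)) :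
    MvPolynomial.rename σ (completePoly k r) = completePoly k r := by
  simp only [completePoly, map_sum, MvPolynomial.rename_monomial]
  refine Finset.sum_bij' (fun g _ => g ∘ σ.symm) (fun g _ => g ∘ σ) ?_ ?_ ?_ ?_ ?_
  · intro g hg
    simp only [Finset.mem_piAntidiag, Finset.mem_univ, implies_true, and_true] at hg ⊢
    rw [← hg]; exact Equiv.sum_comp σ.symm g
  · intro g hg
    simp only [Finset.mem_piAntidiag, Finset.mem_univ, implies_true, and_true] at hg ⊢
    rw [← hg]; exact Equiv.sum_comp σ g
  · intro g _; funext i; simp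
  · intro g _; funext i; simp
  · intro g _
    refine congrArg (fun G => MvPolynomial.monomial G 1) (Finsupp.ext fun i => ?_)
    obtain ⟨j, rfl⟩ := σ.surjective i
    rw [Finsupp.mapDomain_apply σ.injective]
    simp

theorem completePoly_isHomogeneous (k r : ℕ) : (completePoly k r).IsHomogeneous r := by
  refine MvPolynomial.IsHomogeneous.sum _ _ _ fun g hg => ?_
  refine MvPolynomial.isHomogeneous_monomial _ ?_
  simp only [Finset.mem_piAntidiag, Finset.mem_univ, implies_true, and_true] at hg
  rw [Finsupp.degree_eq_sum]
  simpa using hg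

/-- `∏_j h_{α_j}` in `k` variables. -/
def completeProd (k : ℕ) (α : ℕ →₀ ℕ) : MvPolynomial (Fin k) ℕ := α.prod fun _ r => completePoly k r

theorem rename_completeProd {k : ℕ} (α : ℕ →₀ ℕ) (σ : Equiv.Perm (Fin k)) :
    MvPolynomial.rename σ (completeProd k α) = completeProd k α := by
  simp only [completeProd, Finsupp.prod, map_prod, rename_completePoly]

theorem completeProd_isHomogeneous (k : ℕ) (α : ℕ →₀ ℕ) :
    (completeProd k α).IsHomogeneous α.degree :=
  MvPolynomial.IsHomogeneous.prod _ _ _ fun j _ => completePoly_isHomogeneous k (α j)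

theorem completeProd_mapDomain (k : ℕ) (α : ℕ →₀ ℕ) (σ : Equiv.Perm ℕ) :
    completeProd k (α.mapDomain σ) = completeProd k α :=
  Finsupp.prod_mapDomain_index_inj σ.injective

theorem completeProd_eq_prod_range (k : ℕ) (α : ℕ →₀ ℕ) {N : ℕ} (hN : α.support ⊆ Finset.range N) :
    completeProd k α = ∏ j ∈ Finset.range N, completePoly k (α j) :=
  Finsupp.prod_of_support_subset _ hN _ fun _ _ => completePoly_zero k

/-! ### Newton's identities -/

section PowerSum

variable {A : Type*} [CommRing A]

theorem eval_completePoly {k : ℕ} (x : Fin k → A) (r : ℕ) :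
    MvPolynomial.eval₂Hom (Nat.castRingHom A) x (completePoly k r) =
      ∑ g ∈ Finset.piAntidiag Finset.univ r, ∏ i, x i ^ g i := by
  simp only [completePoly, map_sum, MvPolynomial.eval₂Hom_monomial]
  refine Finset.sum_congr rfl fun g _ => ?_
  rw [Finsupp.prod_fintype _ _ (by simp)]
  simp

/-- Write r x^g as the sum over i and 1 ≤ j ≤ g_i of x^g, and split off x_i^j from each term; (g, i,
j) corresponds to (g - j e_i, i, j). -/
theorem eval_completePoly_recurrence {k : ℕ} (x : Fin k → A) (r : ℕ) :
    (r : A) * MvPolynomial.eval₂Hom (Nat.castRingHom A) x (completePoly k r) =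
      ∑ j ∈ Finset.Icc 1 r, (∑ i, x i ^ j) * MvPolynomial.eval₂Hom (Nat.castRingHom A) x (completePoly k (r - j)) := by
  classical
  simp only [eval_completePoly]
  have hL : (r : A) * ∑ g ∈ Finset.piAntidiag Finset.univ r, ∏ i, x i ^ g i =
      ∑ g ∈ Finset.piAntidiag (Finset.univ : Finset (Fin k)) r, ∑ i, ∑ j ∈ Finset.Icc 1 r,
        if j ≤ g i then ∏ i, x i ^ g i else 0 := by
    rw [Finset.mul_sum]
    refine Finset.sum_congr rfl fun g hg => ?_
    simp only [Finset.mem_piAntidiag, Finset.mem_univ, implies_true, and_true] at hg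
    have h1 : ∀ i, ∑ j ∈ Finset.Icc 1 r, (if j ≤ g i then ∏ i, x i ^ g i else 0) =
        (g i : A) * ∏ i, x i ^ g i := by
      intro i
      have hle : g i ≤ r := by
        rw [← hg]; exact Finset.single_le_sum (fun _ _ => Nat.zero_le _) (Finset.mem_univ i)
      rw [← Finset.sum_filter, Finset.sum_const, nsmul_eq_mul]
      congr 2
      rw [show (Finset.Icc 1 r).filter (fun j => j ≤ g i) = Finset.Icc 1 (g i) by
        ext j; simp only [Finset.mem_filter, Finset.mem_Icc]; omega]
      simp
    simp only [h1]
    rw [← Finset.sum_mul, ← hg]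
    push_cast; rfl
  rw [hL, Finset.sum_comm' (s' := fun _ => Finset.piAntidiag Finset.univ r) (t' := Finset.univ)
    (by simp)]
  have hR : ∀ j, (∑ i, x i ^ j) * ∑ g ∈ Finset.piAntidiag Finset.univ (r - j), ∏ i, x i ^ g i =
      ∑ i, ∑ g ∈ Finset.piAntidiag Finset.univ (r - j), x i ^ j * ∏ i, x i ^ g i := fun j => by
    rw [Finset.sum_mul]
    exact Finset.sum_congr rfl fun i _ => by rw [Finset.mul_sum]
  simp only [hR]
  rw [Finset.sum_comm (s := Finset.Icc 1 r)]
  refine Finset.sum_congr rfl fun i _ => ?_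
  rw [Finset.sum_comm]
  refine Finset.sum_congr rfl fun j hj => ?_
  rw [Finset.mem_Icc] at hj
  rw [← Finset.sum_filter]
  refine Finset.sum_bij' (fun g _ => g - Pi.single i j) (fun g _ => g + Pi.single i j)
    ?_ ?_ ?_ ?_ ?_
  · intro g hg
    simp only [Finset.mem_filter, Finset.mem_piAntidiag, Finset.mem_univ, implies_true,
      and_true] at hg ⊢
    have h1 : g = (g - Pi.single i j) + Pi.single i j := by
      funext l
      by_cases hl : l = i
      · subst hl; simp; omega
      · simp [hl]
    have hg1 : ∑ l, g l = r := hg.1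
    have h2 : ∑ l, g l = ∑ l, (g - Pi.single i j : Fin k → ℕ) l + j := by
      conv_lhs => rw [h1]
      simp only [Pi.add_apply, Finset.sum_add_distrib, Finset.sum_pi_single', Finset.mem_univ,
        if_true]
    exact (by omega : ∑ l, (g - Pi.single i j : Fin k → ℕ) l = r - j)
  · intro g hg
    simp only [Finset.mem_filter, Finset.mem_piAntidiag, Finset.mem_univ, implies_true,
      and_true] at hg ⊢
    have hg1 : ∑ l, g l = r - j := hg
    simp only [Pi.add_apply, Finset.sum_add_distrib, Finset.sum_pi_single', Finset.mem_univ,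
        if_true, Pi.single_eq_same]
    omega
  · intro g hg
    simp only [Finset.mem_filter] at hg
    funext l
    by_cases hl : l = i
    · subst hl; simp; omega
    · simp [hl]
  · intro g _
    funext l
    simp
  · intro g hg
    simp only [Finset.mem_filter] at hg
    rw [← Finset.mul_prod_erase _ (fun l => x l ^ g l) (Finset.mem_univ i)]
    conv_rhs => rw [← Finset.mul_prod_erase _ _ (Finset.mem_univ i)]
    rw [← mul_assoc, ← pow_add]
    congr 1
    · congr 1; simp; omega
    · refine Finset.prod_congr rfl fun l hl => ?_
      simp [Finset.ne_of_mem_erase hl]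

/-- `∏_i i^{m_i(s)} m_i(s)!` for a multiset `s`. -/
def multisetZ (s : Multiset ℕ) : ℕ := ∏ i ∈ s.toFinset, i ^ s.count i * (s.count i)!

theorem multisetZ_eq_prod {s : Multiset ℕ} {T : Finset ℕ} (h : s.toFinset ⊆ T) :
    multisetZ s = ∏ i ∈ T, i ^ s.count i * (s.count i)! :=
  Finset.prod_subset h fun i _ hi => by
    rw [Multiset.mem_toFinset] at hi
    simp [Multiset.count_eq_zero_of_notMem hi]

theorem multisetZ_cons (j : ℕ) (s : Multiset ℕ) :
    multisetZ (j ::ₘ s) = j * (s.count j + 1) * multisetZ s := by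
  have hT : j ∈ insert j s.toFinset := Finset.mem_insert_self _ _
  rw [multisetZ_eq_prod (s := s) (Finset.subset_insert j _),
    multisetZ_eq_prod (s := j ::ₘ s) (T := insert j s.toFinset) (by simp),
    ← Finset.mul_prod_erase _ _ hT, ← Finset.mul_prod_erase _ _ hT, ← mul_assoc]
  congr 1
  · rw [Multiset.count_cons_self, pow_succ, Nat.factorial_succ]; ring
  · refine Finset.prod_congr rfl fun i hi => ?_
    rw [Multiset.count_cons_of_ne (Finset.ne_of_mem_erase hi)]

theorem multisetZ_ne_zero {s : Multiset ℕ} (h : ∀ i ∈ s, 0 < i) : multisetZ s ≠ 0 := by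
  refine Finset.prod_ne_zero_iff.2 fun i hi => ?_
  have := h i (Multiset.mem_toFinset.1 hi)
  positivity

variable [Algebra ℂ A]

/-- `∑_{ρ ⊢ r} z_ρ⁻¹ p_{ρ_1} p_{ρ_2} ...`. -/
def partitionSum (p : ℕ → A) (r : ℕ) : A :=
  ∑ ρ : r.Partition, ((partitionZ ρ : ℂ)⁻¹) • (ρ.parts.map p).prod

/-- Write r as the sum of j m_j(ρ) over the distinct parts j of ρ and remove one part j; the factor
is absorbed because z_ρ = j m_j(ρ) z_{ρ∖j}. -/
theorem partitionSum_recurrence (p : ℕ → A) (r : ℕ) :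
    (r : A) * partitionSum p r = ∑ j ∈ Finset.Icc 1 r, p j * partitionSum p (r - j) := by
  classical
  have hL : (r : A) * partitionSum p r = ∑ ρ : r.Partition, ∑ j ∈ Finset.Icc 1 r,
      if j ∈ ρ.parts then ((ρ.parts.count j * j : ℕ) : ℂ) •
        ((partitionZ ρ : ℂ)⁻¹) • (ρ.parts.map p).prod else 0 := by
    rw [partitionSum, Finset.mul_sum]
    refine Finset.sum_congr rfl fun ρ _ => ?_
    rw [← Finset.sum_filter, ← Finset.sum_smul, ← Nat.cast_sum]
    have h1 : (Finset.Icc 1 r).filter (fun j => j ∈ ρ.parts) = ρ.parts.toFinset := by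
      ext j
      simp only [Finset.mem_filter, Finset.mem_Icc, Multiset.mem_toFinset]
      exact ⟨fun h => h.2, fun h => ⟨⟨ρ.parts_pos h, ρ.le_of_mem_parts h⟩, h⟩⟩
    have h2 := Finset.sum_multiset_count ρ.parts
    simp only [smul_eq_mul, ρ.parts_sum] at h2
    rw [h1, ← h2, Nat.cast_smul_eq_nsmul, nsmul_eq_mul]
  rw [hL, Finset.sum_comm]
  refine Finset.sum_congr rfl fun j hj => ?_
  rw [Finset.mem_Icc] at hj
  rw [← Finset.sum_filter, partitionSum, Finset.mul_sum]
  refine Finset.sum_bij'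
    (fun (ρ : r.Partition) (h : ρ ∈ Finset.univ.filter fun ρ : r.Partition => j ∈ ρ.parts) =>
      (⟨ρ.parts.erase j, fun hi => ρ.parts_pos (Multiset.mem_of_mem_erase hi), by
        have h1 := Multiset.sum_erase (Finset.mem_filter.1 h).2
        rw [ρ.parts_sum] at h1; omega⟩ : (r - j).Partition))
    (fun (ρ : (r - j).Partition) _ => (⟨j ::ₘ ρ.parts, fun hi => by
        rcases Multiset.mem_cons.1 hi with rfl | hi
        · omega
        · exact ρ.parts_pos hi, by
        rw [Multiset.sum_cons, ρ.parts_sum]; omega⟩ : r.Partition)) ?_ ?_ ?_ ?_ ?_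
  · intro ρ h; simp
  · intro ρ h; simp
  · intro ρ h
    ext1
    exact Multiset.cons_erase (Finset.mem_filter.1 h).2
  · intro ρ h
    ext1
    simp
  · intro ρ h
    have hmem := (Finset.mem_filter.1 h).2
    have hc : ρ.parts = j ::ₘ ρ.parts.erase j := (Multiset.cons_erase hmem).symm
    have hz : partitionZ ρ = j * ρ.parts.count j * multisetZ (ρ.parts.erase j) := by
      change multisetZ ρ.parts = _
      conv_lhs => rw [hc]
      rw [multisetZ_cons]
      congr 2
      conv_rhs => rw [hc]
      rw [Multiset.count_cons_self]
    have hz0 : (multisetZ (ρ.parts.erase j) : ℂ) ≠ 0 := by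
      exact_mod_cast multisetZ_ne_zero fun i hi => ρ.parts_pos (Multiset.mem_of_mem_erase hi)
    have hj0 : (j : ℂ) ≠ 0 := by exact_mod_cast (show j ≠ 0 by omega)
    have hc0 : (ρ.parts.count j : ℂ) ≠ 0 := by
      exact_mod_cast (Multiset.count_pos.2 hmem).ne'
    rw [smul_smul, hz]
    have hp : (ρ.parts.map p).prod = p j * ((ρ.parts.erase j).map p).prod := by
      conv_lhs => rw [hc, Multiset.map_cons, Multiset.prod_cons]
    rw [hp, mul_smul_comm]
    congr 1
    change _ = ((multisetZ (ρ.parts.erase j) : ℕ) : ℂ)⁻¹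
    push_cast
    field_simp

theorem partitionSum_zero (p : ℕ → A) : partitionSum p 0 = 1 := by
  rw [partitionSum, Fintype.sum_unique]
  simp [partitionZ]

/-- Both sides start at 1 and satisfy the same recurrence, which determines them since r ≥ 1 is
invertible in a ℂ-algebra. -/
theorem partitionSum_psum {k : ℕ} (x : Fin k → A) (r : ℕ) :
    partitionSum (fun j => ∑ i, x i ^ j) r = MvPolynomial.eval₂Hom (Nat.castRingHom A) x (completePoly k r) := by
  induction r using Nat.strong_induction_on with
  | _ r ih =>
    rcases Nat.eq_zero_or_pos r with rfl | hr
    · rw [partitionSum_zero, completePoly_zero, map_one]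
    · have h1 := partitionSum_recurrence (fun j => ∑ i, x i ^ j) r
      have h2 : ∀ j ∈ Finset.Icc 1 r, (∑ i, x i ^ j) * partitionSum (fun j => ∑ i, x i ^ j) (r - j) =
          (∑ i, x i ^ j) * MvPolynomial.eval₂Hom (Nat.castRingHom A) x (completePoly k (r - j)) := fun j hj => by
        rw [Finset.mem_Icc] at hj
        rw [ih (r - j) (by omega)]
      rw [Finset.sum_congr rfl h2, ← eval_completePoly_recurrence] at h1
      have hr0 : (r : ℂ) ≠ 0 := by exact_mod_cast hr.ne'
      have hu : IsUnit (r : A) := by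
        have := (isUnit_iff_ne_zero.2 hr0).map (algebraMap ℂ A)
        simpa using this
      exact hu.mul_left_cancel h1

end PowerSum

/-! ### Counting monomials by their residues -/

theorem congrOrbit_comp {k n : ℕ} {c : Fin k → ℤ} {mu : Fin k → ℕ} (σ : Equiv.Perm (Fin k)) :
    CongrOrbit n (c ∘ σ) mu ↔ CongrOrbit n c mu := by
  constructor
  · rintro ⟨τ, h⟩
    exact ⟨σ⁻¹.trans τ, fun i => by simpa using h (σ⁻¹ i)⟩
  · rintro ⟨τ, h⟩
    exact ⟨σ.trans τ, fun i => h (σ i)⟩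

theorem CongrOrbit.of_dvd {k n : ℕ} {c c' : Fin k → ℤ} {mu : Fin k → ℕ} (h : CongrOrbit n c mu)
    (hc : ∀ i, (n : ℤ) ∣ c' i - c i) : CongrOrbit n c' mu := by
  obtain ⟨σ, hσ⟩ := h
  exact ⟨σ, fun i => by simpa using dvd_add (hc i) (hσ i)⟩

theorem exists_antitone_comp {k : ℕ} (f : Fin k → ℕ) :
    ∃ τ : Equiv.Perm (Fin k), Antitone (f ∘ τ) :=
  ⟨Fin.revPerm.trans (Tuple.sort f), fun i j hij => by
    simpa using Tuple.monotone_sort f (Fin.rev_le_rev.2 hij)⟩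

theorem eq_of_antitone_of_comp_eq {k : ℕ} {f g : Fin k → ℕ} (hf : Antitone f) (hg : Antitone g)
    {σ τ : Equiv.Perm (Fin k)} (h : f ∘ σ = g ∘ τ) : f = g := by
  have hg' : g = f ∘ (τ⁻¹.trans σ) := by
    funext i
    have := congrFun h (τ⁻¹ i)
    simpa using this.symm
  have := Tuple.unique_antitone (f := f) (σ := 1) (τ := τ⁻¹.trans σ) (by simpa using hf)
    (by rw [← hg']; exact hg)
  rw [hg', ← this]; rfl

/-! ### The alcove as a fundamental domain, and counting in orbits -/

theorem eq_of_dvd_sub {n a b : ℕ} (ha : 1 ≤ a ∧ a ≤ n) (hb : 1 ≤ b ∧ b ≤ n)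
    (h : (n : ℤ) ∣ (a : ℤ) - b) : a = b := by
  have h4 : (a : ℤ) - b = 0 := by
    refine Int.eq_zero_of_abs_lt_dvd h ?_
    rw [abs_lt]; constructor <;> omega
  omega

theorem alcove_congrOrbit_unique {k n : ℕ} {c : Fin k → ℤ} {mu nu : Fin k → ℕ}
    (hmu : mu ∈ alcove k n) (hnu : nu ∈ alcove k n) (h : CongrOrbit n c mu)
    (h' : CongrOrbit n c nu) : mu = nu := by
  obtain ⟨σ, hσ⟩ := h
  obtain ⟨τ, hτ⟩ := h'
  refine eq_of_antitone_of_comp_eq hmu.1 hnu.1 (σ := σ) (τ := τ) (funext fun i => ?_)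
  refine eq_of_dvd_sub (hmu.2 _) (hnu.2 _) ?_
  simpa using dvd_sub (hτ i) (hσ i)

theorem exists_alcove_congrOrbit {k n : ℕ} [NeZero n] (c : Fin k → ℤ) :
    ∃ kappa ∈ alcove k n, CongrOrbit n c kappa := by
  have hn : (0 : ℤ) < n := by exact_mod_cast Nat.pos_of_ne_zero (NeZero.ne n)
  let r : Fin k → ℕ := fun i => ((c i - 1) % n).toNat + 1
  have hr : ∀ i, (r i : ℤ) = (c i - 1) % n + 1 := fun i => by
    simp [r, Int.toNat_of_nonneg (Int.emod_nonneg (c i - 1) hn.ne')]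
  obtain ⟨τ, hτ⟩ := exists_antitone_comp r
  refine ⟨r ∘ τ, ⟨hτ, fun i => ?_⟩, τ⁻¹, fun i => ?_⟩
  · have h1 := hr (τ i)
    have h2 := Int.emod_nonneg (c (τ i) - 1) hn.ne'
    have h3 := Int.emod_lt_of_pos (c (τ i) - 1) hn
    simp only [Function.comp_apply]; omega
  · simp only [Function.comp_apply, Equiv.Perm.coe_inv, Equiv.apply_symm_apply, hr]
    refine ⟨(c i - 1) / n, ?_⟩
    linarith [Int.emod_add_mul_ediv (c i - 1) n]

instance alcove_finite (k n : ℕ) : Finite (alcove k n) := by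
  refine Set.Finite.subset (s := ((Fintype.piFinset fun _ : Fin k => Finset.Icc 1 n :
    Finset (Fin k → ℕ)) : Set (Fin k → ℕ))) (Finset.finite_toSet _) ?_
  intro mu hmu
  exact Finset.mem_coe.2 (Fintype.mem_piFinset.2 fun i => Finset.mem_Icc.2 (hmu.2 i))

instance alcoveFintype (k n : ℕ) : Fintype (alcove k n) := Fintype.ofFinite _

open Classical in
/-- The linear form on polynomials sending `X^G` to `1` if `c - G` is congruent to a rearrangement
of `mu`, and to `0` otherwise. -/
def orbitCount {k : ℕ} (n : ℕ) (mu : Fin k → ℕ) (c : Fin k → ℤ) :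
    MvPolynomial (Fin k) ℕ →ₗ[ℕ] ℕ :=
  (MvPolynomial.basisMonomials (Fin k) ℕ).constr ℕ fun G =>
    if CongrOrbit n (fun i => c i - G i) mu then 1 else 0

open Classical in
theorem orbitCount_monomial {k : ℕ} (n : ℕ) (mu : Fin k → ℕ) (c : Fin k → ℤ) (G : Fin k →₀ ℕ)
    (a : ℕ) : orbitCount n mu c (MvPolynomial.monomial G a) =
      if CongrOrbit n (fun i => c i - G i) mu then a else 0 := by
  have h1 : orbitCount n mu c (MvPolynomial.monomial G 1) =
      if CongrOrbit n (fun i => c i - G i) mu then 1 else 0 := by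
    have := (MvPolynomial.basisMonomials (Fin k) ℕ).constr_basis ℕ (fun G =>
      if CongrOrbit n (fun i => c i - G i) mu then 1 else 0) G
    rwa [MvPolynomial.coe_basisMonomials] at this
  rw [show MvPolynomial.monomial G a = a • MvPolynomial.monomial (R := ℕ) G 1 by
    rw [MvPolynomial.smul_monomial]; simp, map_smul, h1]
  simp

open Classical in
theorem orbitCount_eq_sum {k : ℕ} (n : ℕ) (mu : Fin k → ℕ) (c : Fin k → ℤ)
    (p : MvPolynomial (Fin k) ℕ) : orbitCount n mu c p =
      ∑ G ∈ p.support, if CongrOrbit n (fun i => c i - G i) mu then p.coeff G else 0 := by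
  conv_lhs => rw [p.as_sum, map_sum]
  simp only [orbitCount_monomial]

theorem orbitCount_monomial_mul {k : ℕ} (n : ℕ) (mu : Fin k → ℕ) (c : Fin k → ℤ) (g : Fin k →₀ ℕ)
    (p : MvPolynomial (Fin k) ℕ) : orbitCount n mu c (MvPolynomial.monomial g 1 * p) =
      orbitCount n mu (fun i => c i - g i) p := by
  induction p using MvPolynomial.induction_on' with
  | monomial G a =>
    rw [MvPolynomial.monomial_mul, one_mul, orbitCount_monomial, orbitCount_monomial]
    congr 2
    funext i
    simp only [Finsupp.coe_add, Pi.add_apply]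
    push_cast; ring
  | add p q hp hq => rw [mul_add, map_add, map_add, hp, hq]

theorem orbitCount_comp {k : ℕ} (n : ℕ) (mu : Fin k → ℕ) (c : Fin k → ℤ) (σ : Equiv.Perm (Fin k))
    (p : MvPolynomial (Fin k) ℕ) : orbitCount n mu (c ∘ σ) p =
      orbitCount n mu c (MvPolynomial.rename σ p) := by
  induction p using MvPolynomial.induction_on' with
  | monomial G a =>
    rw [MvPolynomial.rename_monomial, orbitCount_monomial, orbitCount_monomial]
    congr 1
    rw [← congrOrbit_comp σ (c := fun i => c i - (Finsupp.mapDomain σ G i : ℤ))]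
    congr 1
    funext i
    simp
  | add p q hp hq => rw [map_add, map_add, map_add, hp, hq]

theorem orbitCount_congr {k n : ℕ} (mu : Fin k → ℕ) {c c' : Fin k → ℤ}
    (h : ∀ i, (n : ℤ) ∣ c i - c' i) (p : MvPolynomial (Fin k) ℕ) :
    orbitCount n mu c p = orbitCount n mu c' p := by
  classical
  rw [orbitCount_eq_sum, orbitCount_eq_sum]
  refine Finset.sum_congr rfl fun G _ => if_congr ⟨fun h1 => ?_, fun h1 => ?_⟩ rfl rfl
  · exact h1.of_dvd fun i => by
      rw [show c' i - G i - (c i - G i) = -(c i - c' i) by ring, dvd_neg]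
      exact h i
  · exact h1.of_dvd fun i => by simpa using h i

/-- Translations by nℤ^k do not change the form, and a permutation of c can be moved onto p, which
is symmetric. -/
theorem orbitCount_of_congrOrbit {k n : ℕ} (mu : Fin k → ℕ) {c : Fin k → ℤ} {kappa : Fin k → ℕ}
    (h : CongrOrbit n c kappa) {p : MvPolynomial (Fin k) ℕ}
    (hp : ∀ σ : Equiv.Perm (Fin k), MvPolynomial.rename σ p = p) :
    orbitCount n mu c p = orbitCount n mu (fun i => (kappa i : ℤ)) p := by
  obtain ⟨σ, hσ⟩ := h
  rw [orbitCount_congr mu hσ p]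
  exact (orbitCount_comp n mu (fun i => (kappa i : ℤ)) σ p).trans (by rw [hp])

open Classical in
/-- The number of `g` with `|g| = r` such that `c - g` is congruent to a rearrangement of `kappa`. -/
def stepCount {k : ℕ} (n : ℕ) (c : Fin k → ℤ) (r : ℕ) (kappa : Fin k → ℕ) : ℕ :=
  ((Finset.piAntidiag Finset.univ r).filter fun g : Fin k → ℕ =>
    CongrOrbit n (fun i => c i - g i) kappa).card

/-- Each monomial x^g of h_r moves c to c - g, which lies in the orbit of exactly one alcove weight
κ; sorting the g by κ gives the transfer matrix `stepCount`. -/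
theorem orbitCount_completePoly_mul {k n : ℕ} [NeZero n] (mu : Fin k → ℕ) (c : Fin k → ℤ) (r : ℕ)
    {p : MvPolynomial (Fin k) ℕ} (hp : ∀ σ : Equiv.Perm (Fin k), MvPolynomial.rename σ p = p) :
    orbitCount n mu c (completePoly k r * p) =
      ∑ kappa : alcove k n, stepCount n c r kappa * orbitCount n mu (fun i => (kappa.1 i : ℤ)) p := by
  classical
  simp only [completePoly, Finset.sum_mul, map_sum, orbitCount_monomial_mul, stepCount,
    Finset.card_filter]
  rw [Finset.sum_comm]
  refine Finset.sum_congr rfl fun g _ => ?_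
  simp only [Finsupp.coe_equivFunOnFinite_symm]
  obtain ⟨kappa, hk, h⟩ := exists_alcove_congrOrbit (n := n) fun i => c i - g i
  rw [Finset.sum_eq_single ⟨kappa, hk⟩, if_pos h, one_mul]
  · exact orbitCount_of_congrOrbit mu h hp
  · intro b _ hb
    rw [if_neg, zero_mul]
    intro h'
    exact hb (Subtype.ext (alcove_congrOrbit_unique b.2 hk h' h))
  · simp

theorem stepCount_zero_self {k : ℕ} (n : ℕ) (lam : Fin k → ℕ) :
    stepCount n (fun i => (lam i : ℤ)) 0 lam = 1 := by
  classical
  rw [stepCount, Finset.piAntidiag_zero, Finset.filter_singleton, if_pos, Finset.card_singleton]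
  exact ⟨1, fun i => by simp⟩

theorem stepCount_eq_cylTheta {k n : ℕ} [NeZero k] [NeZero n] {lam mu : Fin k → ℕ}
    (hmu : mu ∈ alcove k n) {d : ℤ} {r : ℕ}
    (h : (weightSize lam + d * n : ℤ) = r + weightSize mu) :
    cylTheta n lam d mu = stepCount n (fun i => (lam i : ℤ)) r mu := by
  classical
  rw [cylTheta_eq_ncard lam d hmu, stepCount, ← Set.ncard_coe_finset]
  congr 1
  ext g
  simp only [Set.mem_ofPred_eq, Finset.coe_filter, Finset.mem_piAntidiag, Finset.mem_univ,
    implies_true, and_true]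
  refine and_congr_left fun _ => ?_
  have : (∑ i, (g i : ℤ)) = ((Finset.univ.sum g : ℕ) : ℤ) := by push_cast; rfl
  rw [this]
  omega

theorem exists_degree_of_stepCount_ne_zero {k n : ℕ} [NeZero n] {lam mu : Fin k → ℕ}
    (hlam : lam ∈ alcove k n) (hmu : mu ∈ alcove k n) {r : ℕ}
    (h : stepCount n (fun i => (lam i : ℤ)) r mu ≠ 0) :
    ∃ D : ℕ, weightSize lam + D * n = r + weightSize mu := by
  classical
  obtain ⟨g, hg⟩ := Finset.card_pos.1 (Nat.pos_of_ne_zero h)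
  simp only [Finset.mem_filter, Finset.mem_piAntidiag, Finset.mem_univ, implies_true,
    and_true] at hg
  obtain ⟨D, hD⟩ := CongrOrbit.exists_degree hlam hmu hg.2
  exact ⟨D, by rw [hD]; congr 1; exact hg.1⟩

/-- Iteration of `orbitCount_completePoly_mul`: the last step of the path, ending at λ, is the
factor h_{α_{N-1}} and is peeled off first, while for N = 0 the form evaluates 1 to the indicator of
μ = λ. -/
theorem sum_paths {k n : ℕ} [NeZero n] (mu : alcove k n) (α : ℕ → ℕ) (N : ℕ) (lam : alcove k n)
    [DecidableEq (alcove k n)] :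
    (∑ kappa : Fin (N + 1) → alcove k n,
      if kappa 0 = mu ∧ kappa (Fin.last N) = lam then
        ∏ i : Fin N, stepCount n (fun a => ((kappa i.succ).1 a : ℤ)) (α i) (kappa i.castSucc).1
      else 0) =
    orbitCount n mu.1 (fun a => (lam.1 a : ℤ)) (∏ j ∈ Finset.range N, completePoly k (α j)) := by
  classical
  induction N generalizing lam with
  | zero =>
    rw [Finset.range_zero, Finset.prod_empty, ← MvPolynomial.C_1, ← MvPolynomial.monomial_zero',
      orbitCount_monomial]
    simp only [Finsupp.coe_zero, Pi.zero_apply, Nat.cast_zero, sub_zero, Finset.univ_eq_empty,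
      Finset.prod_empty, Fin.last_zero]
    rw [← (Equiv.funUnique (Fin 1) (alcove k n)).symm.sum_comp]
    have h1 : CongrOrbit n (fun i => (lam.1 i : ℤ)) mu.1 ↔ mu = lam := by
      constructor
      · intro h
        exact Subtype.ext (alcove_congrOrbit_unique mu.2 lam.2 h ⟨1, fun i => by simp⟩)
      · rintro rfl; exact ⟨1, fun i => by simp⟩
    rw [Finset.sum_eq_single mu]
    · simp [h1]
    · intro b _ hb
      rw [if_neg]
      rintro ⟨h2, -⟩
      exact hb h2
    · simp
  | succ N ih =>
    have hsym : ∀ σ : Equiv.Perm (Fin k),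
        MvPolynomial.rename σ (∏ j ∈ Finset.range N, completePoly k (α j)) =
          ∏ j ∈ Finset.range N, completePoly k (α j) := fun σ => by
      simp only [map_prod, rename_completePoly]
    rw [Finset.prod_range_succ, mul_comm, orbitCount_completePoly_mul _ _ _ hsym]
    simp only [← ih, Finset.mul_sum]
    rw [Finset.sum_comm, ← (Fin.snocEquiv (fun _ : Fin (N + 2) => alcove k n)).sum_comp,
      Fintype.sum_prod_type_right]
    refine Finset.sum_congr rfl fun kappa _ => ?_
    rw [Finset.sum_eq_single lam, Finset.sum_eq_single (kappa (Fin.last N))]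
    · have h0 : (Fin.snocEquiv (fun _ : Fin (N + 2) => alcove k n)) (lam, kappa) 0 = kappa 0 := by
        exact Fin.snoc_castSucc (α := fun _ : Fin (N + 2) => alcove k n) lam kappa 0
      have hl : (Fin.snocEquiv (fun _ : Fin (N + 2) => alcove k n)) (lam, kappa)
          (Fin.last (N + 1)) = lam := by
        simp [Fin.snocEquiv]
      have hc : ∀ i : Fin (N + 1), (Fin.snocEquiv (fun _ : Fin (N + 2) => alcove k n)) (lam, kappa)
          i.castSucc = kappa i := fun i => by simp [Fin.snocEquiv]
      rw [h0, hl, Fin.prod_univ_castSucc]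
      simp only [hc, Fin.succ_last, hl, Fin.succ_castSucc, and_true, Fin.val_last,
        Fin.val_castSucc]
      split_ifs
      · rw [mul_comm]
      · simp
    · intro b _ hb
      rw [if_neg, mul_zero]
      rintro ⟨-, h⟩
      exact hb h.symm
    · simp
    · intro b _ hb
      rw [if_neg]
      rintro ⟨-, h⟩
      exact hb (by simpa [Fin.snocEquiv] using h)
    · simp

/-! ### Coefficients of the cylindric complete symmetric functions -/

namespace CylRPP

variable {k n : ℕ} [NeZero k] {lam mu : Fin k → ℕ} {d : ℤ}

theorem loop_le_sub (p : CylRPP k n lam d mu) (i : ℕ) (a : ℤ) :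
    cylLoop n (p.part i) 0 a ≤ cylLoop n (p.part (i + 1)) (p.deg (i + 1) - p.deg i) a := by
  have := p.loop_le i (a + p.deg i)
  simp only [cylLoop] at this ⊢
  convert this using 2 <;> ring

theorem size_step (p : CylRPP k n lam d mu) (i : ℕ) :
    (weightSize (p.part (i + 1)) + (p.deg (i + 1) - p.deg i) * n : ℤ) =
      p.wt i + weightSize (p.part i) := by
  have := ncard_cylShape (p.loop_le_sub i)
  rw [CylRPP.wt, this]; ring

theorem size_eq (p : CylRPP k n lam d mu) (i : ℕ) :
    (weightSize (p.part i) + p.deg i * n : ℤ) = ∑ j ∈ Finset.range i, p.wt j + weightSize mu := by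
  induction i with
  | zero => simp [p.part_zero, p.deg_zero]
  | succ i ih =>
    rw [Finset.sum_range_succ]
    push_cast at ih ⊢
    linarith [p.size_step i]

/-- A step of weight zero is constant, so the sequence is constant from N on and equals its eventual
value. -/
theorem eq_of_wt_eq_zero (p : CylRPP k n lam d mu) {N : ℕ} (h : ∀ i, N ≤ i → p.wt i = 0) (i : ℕ)
    (hi : N ≤ i) : p.part i = lam ∧ p.deg i = d := by
  have hstep : ∀ i, N ≤ i → p.part (i + 1) = p.part i ∧ p.deg (i + 1) = p.deg i := by
    intro i hi
    have h1 := p.size_step i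
    rw [h i hi, Nat.cast_zero, zero_add] at h1
    have h2 := eq_of_cylLoop_le_of_size_eq (p.part_mem (i + 1)) (p.part_mem i) (p.loop_le_sub i) h1
    exact ⟨h2.1.symm, by linarith [h2.2]⟩
  have hall : ∀ m, p.part (i + m) = p.part i ∧ p.deg (i + m) = p.deg i := by
    intro m
    induction m with
    | zero => exact ⟨rfl, rfl⟩
    | succ m ih =>
      have := hstep (i + m) (by omega)
      rw [← add_assoc]
      exact ⟨this.1.trans ih.1, this.2.trans ih.2⟩
  obtain ⟨l, hl⟩ := p.eventually_eq
  have h1 := hall l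
  have h2 := hl (i + l) (by omega)
  exact ⟨h1.1.symm.trans h2.1, h1.2.symm.trans h2.2⟩

theorem step_theta [NeZero n] (p : CylRPP k n lam d mu) (i : ℕ) :
    cylTheta n (p.part (i + 1)) (p.deg (i + 1) - p.deg i) (p.part i) =
      stepCount n (fun a => (p.part (i + 1) a : ℤ)) (p.wt i) (p.part i) :=
  stepCount_eq_cylTheta (p.part_mem i) (p.size_step i)

theorem theta_eq_prod [NeZero n] (p : CylRPP k n lam d mu) {N : ℕ}
    (h : ∀ i, N ≤ i → p.wt i = 0) : p.theta =
      ∏ i : Fin N, stepCount n (fun a => (p.part (i + 1) a : ℤ)) (p.wt i) (p.part i) := by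
  rw [CylRPP.theta, finprod_eq_prod_of_mulSupport_subset (s := Finset.range N), Finset.prod_range]
  · exact Finset.prod_congr rfl fun i _ => p.step_theta i
  · intro i hi
    rw [Finset.coe_range, Set.mem_Iio]
    by_contra hcon
    refine hi ?_
    change cylTheta n (p.part (i + 1)) (p.deg (i + 1) - p.deg i) (p.part i) = 1
    rw [p.step_theta, h i (by omega), (p.eq_of_wt_eq_zero h i (by omega)).1,
      (p.eq_of_wt_eq_zero h (i + 1) (by omega)).1, stepCount_zero_self]

/-- The sequence of the first `N + 1` partitions. -/
def toPath (p : CylRPP k n lam d mu) (N : ℕ) : Fin (N + 1) → alcove k n :=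
  fun i => ⟨p.part i, p.part_mem i⟩

/-- The weights and the partitions determine the degrees, because `size_eq` gives the value of n
d_i. -/
theorem toPath_injOn [NeZero n] {α : ℕ →₀ ℕ} {N : ℕ} (hN : α.support ⊆ Finset.range N) :
    Set.InjOn (fun p : CylRPP k n lam d mu => p.toPath N) (cylRPPOfWeight n lam d mu α) := by
  intro p hp q hq h
  have hz : ∀ i, N ≤ i → α i = 0 := fun i hi => by
    by_contra hcon
    have := Finset.mem_range.1 (hN (Finsupp.mem_support_iff.2 hcon))
    omega
  have hpart : p.part = q.part := by
    funext i
    by_cases hi : i < N + 1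
    · exact congrArg Subtype.val (congrFun h ⟨i, hi⟩)
    · rw [(p.eq_of_wt_eq_zero (fun i hi => (hp i).trans (hz i hi)) i (by omega)).1,
        (q.eq_of_wt_eq_zero (fun i hi => (hq i).trans (hz i hi)) i (by omega)).1]
  have hdeg : p.deg = q.deg := by
    funext i
    have h1 := p.size_eq i
    have h2 := q.size_eq i
    have h3 : ∀ j, p.wt j = q.wt j := fun j => (hp j).trans (hq j).symm
    simp only [h3] at h1
    rw [← h2, hpart] at h1
    have hn : (n : ℤ) ≠ 0 := by exact_mod_cast NeZero.ne n
    exact mul_right_cancel₀ hn (by linarith)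
  exact CylRPP.ext hpart hdeg

/-- Nonzero step counts supply everything that a CRPP has beyond its partitions: the degree
increments through sizes, and the inequalities of loops because the corresponding θ is nonzero. -/
theorem exists_of_path [NeZero n] {α : ℕ →₀ ℕ} {N : ℕ}
    (hN : α.support ⊆ Finset.range N)
    (hsize : (weightSize lam + d * n : ℤ) = α.degree + weightSize mu)
    (kappa : Fin (N + 1) → alcove k n) (h0 : (kappa 0).1 = mu) (hl : (kappa (Fin.last N)).1 = lam)
    (hne : ∀ i : Fin N,
      stepCount n (fun a => ((kappa i.succ).1 a : ℤ)) (α i) (kappa i.castSucc).1 ≠ 0) :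
    ∃ p ∈ cylRPPOfWeight n lam d mu α, p.toPath N = kappa := by
  have hn : (n : ℤ) ≠ 0 := by exact_mod_cast NeZero.ne n
  have hz : ∀ i, N ≤ i → α i = 0 := fun i hi => by
    by_contra hcon
    have := Finset.mem_range.1 (hN (Finsupp.mem_support_iff.2 hcon))
    omega
  -- The path is continued by its last vertex λ beyond N, where α vanishes.
  let part : ℕ → Fin k → ℕ := fun i => (kappa ⟨min i N, by omega⟩).1
  have hpart_mem : ∀ i, part i ∈ alcove k n := fun i => (kappa _).2
  have hpart_ge : ∀ i, N ≤ i → part i = lam := fun i hi => by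
    rw [← hl]
    simp only [part]
    congr 2
    exact Fin.ext (by simp; omega)
  have hstep : ∀ i, stepCount n (fun a => (part (i + 1) a : ℤ)) (α i) (part i) ≠ 0 := by
    intro i
    by_cases hi : i < N
    · have h1 := hne ⟨i, hi⟩
      have e1 : part (i + 1) = (kappa (⟨i, hi⟩ : Fin N).succ).1 := by
        simp only [part]
        congr 2
        exact Fin.ext (by simp; omega)
      have e2 : part i = (kappa (⟨i, hi⟩ : Fin N).castSucc).1 := by
        simp only [part]
        congr 2
        exact Fin.ext (by simp; omega)
      rw [e1, e2]
      exact h1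
    · rw [hz i (by omega), hpart_ge i (by omega), hpart_ge (i + 1) (by omega), stepCount_zero_self]
      exact one_ne_zero
  choose D hD using fun i =>
    exists_degree_of_stepCount_ne_zero (hpart_mem (i + 1)) (hpart_mem i) (hstep i)
  let deg : ℕ → ℤ := fun i => ∑ j ∈ Finset.range i, (D j : ℤ)
  have hdeg : ∀ i, deg (i + 1) - deg i = D i := fun i => by
    simp only [deg, Finset.sum_range_succ]; ring
  have hDz : ∀ i, (weightSize (part (i + 1)) + (deg (i + 1) - deg i) * n : ℤ) =
      α i + weightSize (part i) := fun i => by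
    rw [hdeg]; exact_mod_cast hD i
  have hdegsum : ∀ i, (weightSize (part i) + deg i * n : ℤ) =
      ∑ j ∈ Finset.range i, (α j : ℤ) + weightSize mu := by
    intro i
    induction i with
    | zero =>
      have : part 0 = mu := by rw [← h0]; simp [part]
      simp [deg, this]
    | succ i ih =>
      rw [Finset.sum_range_succ]
      linarith [hDz i]
  have hloop : ∀ i a, cylLoop n (part i) 0 a ≤ cylLoop n (part (i + 1)) (deg (i + 1) - deg i) a := by
    intro i a
    refine cylLoop_le_of_cylTheta_ne_zero (hpart_mem _) (hpart_mem _) ?_ a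
    rw [stepCount_eq_cylTheta (hpart_mem i) (hDz i)]
    exact hstep i
  have hdeg_ge : ∀ i, N ≤ i → deg i = d := by
    intro i hi
    have h1 := hdegsum i
    have h2 : (α.degree : ℤ) = ∑ j ∈ Finset.range i, (α j : ℤ) := by
      rw [Finsupp.degree_apply, ← Nat.cast_sum]
      congr 1
      refine Finset.sum_subset (hN.trans (Finset.range_mono hi)) fun j _ hj => ?_
      simpa using hj
    rw [hpart_ge i hi, ← h2, ← hsize] at h1
    exact mul_right_cancel₀ hn (by linarith)
  let p : CylRPP k n lam d mu :=
    { part := part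
      deg := deg
      part_mem := hpart_mem
      deg_mono := fun i => by have := hdeg i; omega
      loop_le := fun i a => by
        have := hloop i (a - deg i)
        simp only [cylLoop] at this ⊢
        convert this using 2 <;> ring
      part_zero := by rw [← h0]; simp [part]
      deg_zero := by simp [deg]
      eventually_eq := ⟨N, fun i hi => ⟨hpart_ge i hi, hdeg_ge i hi⟩⟩ }
  refine ⟨p, fun i => ?_, ?_⟩
  · have h1 := p.size_step i
    have h2 := hDz i
    change (weightSize (part (i + 1)) + (deg (i + 1) - deg i) * n : ℤ) = _ at h1
    change _ = (p.wt i + weightSize (part i) : ℤ) at h1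
    omega
  · funext i
    refine Subtype.ext ?_
    simp only [toPath, p, part]
    congr 2
    exact Fin.ext (by simp; omega)

end CylRPP

theorem exists_support_subset_range (α : ℕ →₀ ℕ) : ∃ N, α.support ⊆ Finset.range N :=
  Finset.exists_nat_subset_range _

theorem cylRPPOfWeight_finite {k n : ℕ} [NeZero k] [NeZero n] (lam : Fin k → ℕ) (d : ℤ)
    (mu : Fin k → ℕ) (α : ℕ →₀ ℕ) : (cylRPPOfWeight n lam d mu α).Finite := by
  obtain ⟨N, hN⟩ := exists_support_subset_range α
  exact Set.Finite.of_finite_image (Set.toFinite _) (CylRPP.toPath_injOn hN)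

/-- CRPPs of weight α embed into paths in the alcove with matching θ, and `sum_paths` evaluates the
sum over paths. -/
theorem coeff_cylH {k n : ℕ} [NeZero k] [NeZero n] {lam mu : Fin k → ℕ} (hlam : lam ∈ alcove k n)
    (hmu : mu ∈ alcove k n) (d : ℤ) (α : ℕ →₀ ℕ) [Decidable
      ((weightSize lam + d * n : ℤ) = α.degree + weightSize mu)] :
    MvPowerSeries.coeff α (cylH n lam d mu) =
      if (weightSize lam + d * n : ℤ) = α.degree + weightSize mu then
        (orbitCount n mu (fun a => (lam a : ℤ)) (completeProd k α) : ℂ) else 0 := by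
  classical
  obtain ⟨N, hN⟩ := exists_support_subset_range α
  have hz : ∀ i, N ≤ i → α i = 0 := fun i hi => by
    by_contra hcon
    have := Finset.mem_range.1 (hN (Finsupp.mem_support_iff.2 hcon))
    omega
  have hdegree : α.degree = ∑ j ∈ Finset.range N, α j := by
    rw [Finsupp.degree_apply]
    exact Finset.sum_subset hN fun j _ hj => by simpa using hj
  change ∑ᶠ p ∈ cylRPPOfWeight n lam d mu α, (p.theta : ℂ) = _
  split_ifs with hsize
  · rw [completeProd_eq_prod_range k α hN, ← sum_paths ⟨mu, hmu⟩ α N ⟨lam, hlam⟩]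
    set F : (Fin (N + 1) → alcove k n) → ℕ := fun kappa =>
      if kappa 0 = ⟨mu, hmu⟩ ∧ kappa (Fin.last N) = ⟨lam, hlam⟩ then
        ∏ i : Fin N, stepCount n (fun a => ((kappa i.succ).1 a : ℤ)) (α i) (kappa i.castSucc).1
      else 0 with hF
    have h1 : ∀ p ∈ cylRPPOfWeight n lam d mu α, (p.theta : ℂ) = (F (p.toPath N) : ℂ) := by
      intro p hp
      have hw : ∀ i, N ≤ i → p.wt i = 0 := fun i hi => (hp i).trans (hz i hi)
      rw [p.theta_eq_prod hw, hF]
      simp only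
      rw [if_pos]
      · congr 1
        refine Finset.prod_congr rfl fun i _ => ?_
        rw [hp i]
        simp [CylRPP.toPath]
      · refine ⟨Subtype.ext ?_, Subtype.ext ?_⟩
        · simp [CylRPP.toPath, p.part_zero]
        · simp [CylRPP.toPath, (p.eq_of_wt_eq_zero hw N le_rfl).1]
    rw [finsum_mem_congr rfl h1, ← finsum_mem_image (f := fun kappa => (F kappa : ℂ))
      (CylRPP.toPath_injOn hN), Nat.cast_sum, ← finsum_eq_sum_of_fintype]
    change _ = ∑ᶠ kappa, (F kappa : ℂ)
    rw [← finsum_mem_univ (fun kappa => (F kappa : ℂ))]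
    -- Paths that do not come from a CRPP contribute zero, so the sum extends to all paths.
    refine finsum_mem_inter_support_eq' (M := ℂ) _ _ _ fun kappa hkappa => ?_
    simp only [Set.mem_univ, iff_true]
    have hne : F kappa ≠ 0 := by
      intro h; exact hkappa (by simp [h])
    rw [hF] at hne
    simp only [ne_eq, ite_eq_right_iff, not_forall] at hne
    obtain ⟨⟨h2, h3⟩, h4⟩ := hne
    obtain ⟨p, hp, hpk⟩ := CylRPP.exists_of_path hN hsize kappa (congrArg Subtype.val h2)
      (congrArg Subtype.val h3) fun i => Finset.prod_ne_zero_iff.1 h4 i (Finset.mem_univ i)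
    exact ⟨p, hp, hpk⟩
  · refine finsum_mem_of_eqOn_zero (M := ℂ) fun p hp => ?_
    exfalso
    apply hsize
    have hw : ∀ i, N ≤ i → p.wt i = 0 := fun i hi => (hp i).trans (hz i hi)
    have h1 := p.size_eq N
    have h2 := p.eq_of_wt_eq_zero hw N le_rfl
    rw [h2.1, h2.2] at h1
    rw [h1, hdegree]
    congr 2
    exact Finset.sum_congr rfl fun j _ => by rw [hp j]

/-! ### The expansion in complete symmetric functions -/

/-- Exchange of the two indices of a finitely supported matrix. -/
def finsuppTranspose {ι κ : Type*} (l : ι →₀ κ →₀ ℕ) : κ →₀ ι →₀ ℕ :=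
  (Finsupp.equivMapDomain (Equiv.prodComm ι κ) l.uncurry).curry

theorem finsuppTranspose_apply {ι κ : Type*} (l : ι →₀ κ →₀ ℕ) (i : ι) (j : κ) :
    finsuppTranspose l j i = l i j := by
  simp [finsuppTranspose, Finsupp.curry_apply, Finsupp.uncurry_apply]

theorem finsuppTranspose_transpose {ι κ : Type*} (l : ι →₀ κ →₀ ℕ) :
    finsuppTranspose (finsuppTranspose l) = l := by
  ext i j
  rw [finsuppTranspose_apply, finsuppTranspose_apply]

theorem coeff_completePoly {k : ℕ} (r : ℕ) (G : Fin k →₀ ℕ) :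
    (completePoly k r).coeff G = if G.degree = r then 1 else 0 := by
  classical
  rw [completePoly, MvPolynomial.coeff_sum]
  simp only [MvPolynomial.coeff_monomial]
  by_cases h : G.degree = r
  · rw [if_pos h, Finset.sum_eq_single (fun i => G i), if_pos]
    · ext i; simp
    · intro g _ hg
      rw [if_neg]
      rintro rfl
      exact hg (by funext i; simp)
    · intro h'
      exfalso; apply h'
      rw [Finsupp.degree_eq_sum] at h
      simpa using h
  · rw [if_neg h, Finset.sum_eq_zero]
    intro g hg
    rw [if_neg]
    rintro rfl
    apply h
    simp only [Finset.mem_piAntidiag, Finset.mem_univ, implies_true, and_true] at hg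
    rw [Finsupp.degree_eq_sum]
    simpa using hg

/-- Both coefficients count matrices over ℕ with row sums G and column sums α; the bijection is
transposition. -/
theorem coeff_completeHPart {k : ℕ} (G : Fin k →₀ ℕ) (α : ℕ →₀ ℕ) :
    MvPowerSeries.coeff α (completeHPart G) = (((completeProd k α).coeff G : ℕ) : ℂ) := by
  classical
  obtain ⟨N, hN⟩ := exists_support_subset_range α
  have hind : ∀ {ι : Type} (s : Finset ι) (P : ι → Prop) {R : Type} [CommSemiring R]
      [DecidablePred P], (∏ i ∈ s, if P i then (1 : R) else 0) = if ∀ i ∈ s, P i then 1 else 0 := by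
    intro ι s P R _ _
    rw [Finset.prod_ite_zero]; simp
  rw [completeHPart, MvPowerSeries.coeff_prod, completeProd_eq_prod_range k α hN,
    ← MvPolynomial.coeff_coe, ← MvPolynomial.coeToMvPowerSeries.ringHom_apply, map_prod,
    MvPowerSeries.coeff_prod]
  have h1 : ∀ (β : ℕ →₀ ℕ) (r : ℕ), MvPowerSeries.coeff β (completeH r) =
    if β.degree = r then (1 : ℂ) else 0 := fun β r => rfl
  simp only [h1, MvPolynomial.coeToMvPowerSeries.ringHom_apply, MvPolynomial.coeff_coe,
    coeff_completePoly, hind]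
  rw [Finset.sum_boole, Nat.cast_id]
  trans (((Finset.finsuppAntidiag Finset.univ α).filter fun l =>
    ∀ i ∈ Finset.univ, (l i).degree = G i).card : ℂ)
  · rw [Finset.card_filter, Nat.cast_sum]
    refine Finset.sum_congr rfl fun l _ => ?_
    split_ifs <;> simp
  congr 1
  refine Finset.card_bij' (fun l _ => finsuppTranspose l) (fun l _ => finsuppTranspose l) ?_ ?_
    (fun l _ => finsuppTranspose_transpose l) (fun l _ => finsuppTranspose_transpose l)
  · intro l hl
    simp only [Finset.mem_filter, Finset.mem_finsuppAntidiag, Finset.mem_univ, true_implies,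
      Finset.subset_univ, and_true] at hl ⊢
    obtain ⟨h2, h3⟩ := hl
    have h4 : ∀ j, ∑ i, l i j = α j := fun j => by
      rw [← h2, Finsupp.finsetSum_apply]
    have h5 : ∀ i j, α j = 0 → l i j = 0 := fun i j hj => by
      rw [← h4] at hj
      exact Finset.sum_eq_zero_iff.1 hj i (Finset.mem_univ i)
    refine ⟨⟨?_, ?_⟩, ?_⟩
    · ext i
      rw [Finsupp.finsetSum_apply, ← h3 i, Finsupp.degree_apply]
      simp only [finsuppTranspose_apply]
      refine (Finset.sum_subset ?_ ?_).symm
      · intro j hj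
        apply hN
        rw [Finsupp.mem_support_iff] at hj ⊢
        exact fun h => hj (h5 i j h)
      · intro j _ hj; simpa using hj
    · intro j hj
      rw [Finsupp.mem_support_iff] at hj
      apply hN
      rw [Finsupp.mem_support_iff]
      intro h
      apply hj
      ext i
      rw [finsuppTranspose_apply, h5 i j h]; rfl
    · intro j _
      rw [Finsupp.degree_eq_sum, ← h4]
      simp only [finsuppTranspose_apply]
  · intro l hl
    simp only [Finset.mem_filter, Finset.mem_finsuppAntidiag, Finset.mem_univ, true_implies,
      Finset.subset_univ, and_true] at hl ⊢
    obtain ⟨⟨h2, h2'⟩, h3⟩ := hl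
    have h6 : ∀ j, j ∉ Finset.range N → ∀ i, l j i = 0 := fun j hj i => by
      have : l j = 0 := by
        by_contra h
        exact hj (h2' (Finsupp.mem_support_iff.2 h))
      rw [this]; rfl
    refine ⟨?_, ?_⟩
    · ext j
      rw [Finsupp.finsetSum_apply]
      simp only [finsuppTranspose_apply]
      by_cases hj : j ∈ Finset.range N
      · rw [← h3 j hj, Finsupp.degree_eq_sum]
      · simp only [h6 j hj, Finset.sum_const_zero]
        by_contra h
        exact hj (hN (Finsupp.mem_support_iff.2 (Ne.symm h)))
    · intro i
      rw [← h2, Finsupp.finsetSum_apply, Finsupp.degree_apply]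
      simp only [finsuppTranspose_apply]
      refine Finset.sum_subset ?_ ?_
      · intro j hj
        by_contra h
        rw [Finsupp.mem_support_iff, finsuppTranspose_apply] at hj
        exact hj (h6 j h i)
      · intro j _ hj; simpa [finsuppTranspose_apply] using hj

theorem completeHPart_comp {k : ℕ} (nu : Fin k → ℕ) (σ : Equiv.Perm (Fin k)) :
    completeHPart (nu ∘ σ) = completeHPart nu :=
  Equiv.prod_comp σ fun i => completeH (nu i)

open Classical in
-- The pair (w, w') is recorded by G = ν ∘ w'. It determines w' by minimality, and it determines μ ∘
-- w modulo n, hence exactly because the entries of μ lie in 1, ..., n; so w is determined too.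
theorem fusionCoeff_eq_card {k n : ℕ} [NeZero k] {mu nu lam : Fin k → ℕ} (hmu : mu ∈ alcove k n)
    (hnu : Antitone nu) : fusionCoeff n mu nu lam =
      ((Finset.piAntidiag Finset.univ (weightSize nu)).filter fun G : Fin k → ℕ =>
        (∃ w : Equiv.Perm (Fin k), nu ∘ w = G) ∧
          CongrOrbit n (fun i => (lam i : ℤ) - G i) mu).card := by
  rw [fusionCoeff, ← Set.InjOn.ncard_image (f := fun p => nu ∘ p.2), ← Set.ncard_coe_finset]
  · congr 1
    ext G
    simp only [Finset.coe_filter, Finset.mem_piAntidiag, Finset.mem_univ, implies_true, and_true,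
      Set.mem_image, Set.mem_ofPred_eq, Prod.exists]
    constructor
    · rintro ⟨w, w', ⟨hw, hw', γ, hγ⟩, rfl⟩
      refine ⟨Equiv.sum_comp w' nu, ⟨w', rfl⟩, w, fun i => ⟨-γ i, ?_⟩⟩
      simp only [Function.comp_apply]
      linarith [hγ i]
    · rintro ⟨-, ⟨v', rfl⟩, v, hv⟩
      obtain ⟨w, hw, hwv⟩ := exists_mem_finiteReps mu v
      obtain ⟨w', hw', hwv'⟩ := exists_mem_finiteReps nu v'
      choose γ hγ using hv
      refine ⟨w, w', ⟨hw, hw', fun i => -γ i, fun i => ?_⟩, hwv'⟩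
      have e1 : mu (w i) = mu (v i) := congrFun hwv i
      have e2 : nu (w' i) = nu (v' i) := congrFun hwv' i
      rw [e1, e2]
      have := hγ i
      simp only [Function.comp_apply] at this
      linarith
  · rintro ⟨w, w'⟩ ⟨hw, hw', γ, hγ⟩ ⟨v, v'⟩ ⟨hv, hv', δ, hδ⟩ h
    simp only at h hw hw' hv hv' hγ hδ
    refine Prod.ext (finiteReps_injOn hmu.1 hw hv (funext fun i => ?_))
      (finiteReps_injOn hnu hw' hv' h)
    refine eq_of_dvd_sub (hmu.2 _) (hmu.2 _) ⟨γ i - δ i, ?_⟩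
    have e : nu (w' i) = nu (v' i) := congrFun h i
    have h1 := hγ i
    have h2 := hδ i
    rw [e] at h1
    simp only [Function.comp_apply]
    linarith

open Classical in
theorem sum_piAntidiag_eq_orbitCount {k : ℕ} (n : ℕ) (mu : Fin k → ℕ) (c : Fin k → ℤ) (r : ℕ)
    (α : ℕ →₀ ℕ) : (∑ G ∈ Finset.piAntidiag Finset.univ r,
      if CongrOrbit n (fun i => c i - G i) mu then
        (completeProd k α).coeff (Finsupp.equivFunOnFinite.symm G) else 0) =
      if α.degree = r then orbitCount n mu c (completeProd k α) else 0 := by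
  have hhom := completeProd_isHomogeneous k α
  split_ifs with hr
  · rw [orbitCount_eq_sum]
    symm
    refine Finset.sum_bij_ne_zero (fun G _ _ => fun i => G i) ?_ ?_ ?_ ?_
    · intro G hG _
      have := hhom (MvPolynomial.mem_support_iff.1 hG)
      replace this : G.degree = α.degree := by rw [Finsupp.degree_eq_weight_one]; exact this
      simp only [Finset.mem_piAntidiag, Finset.mem_univ, implies_true, and_true]
      rw [← hr, ← this, Finsupp.degree_eq_sum]
    · intro G _ _ G' _ _ h
      ext i; exact congrFun h i
    · intro G hG hne
      refine ⟨Finsupp.equivFunOnFinite.symm G, ?_, ?_, ?_⟩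
      · rw [MvPolynomial.mem_support_iff]
        intro h0; apply hne; rw [h0]; simp
      · simpa using hne
      · funext i; simp
    · intro G _ _
      have : Finsupp.equivFunOnFinite.symm (fun i => G i) = G := by ext i; simp
      rw [this]
  · refine Finset.sum_eq_zero fun G hG => ?_
    rw [hhom.coeff_eq_zero, ite_self]
    simp only [Finset.mem_piAntidiag, Finset.mem_univ, implies_true, and_true] at hG
    intro h
    apply hr
    rw [← hG, ← h, Finsupp.degree_eq_sum]
    simp

/-- h_G depends only on the decreasing rearrangement ν of G, so the sum over ν weighted by fusion
coefficients is a sum over all G of size r with λ - G in the orbit of μ. By `coeff_completeHPart`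
this is the form applied to ∏_j h_{α_j}. -/
theorem coeff_sum_fusionCoeff {k n : ℕ} [NeZero k] {lam mu : Fin k → ℕ} (hmu : mu ∈ alcove k n)
    (d : ℤ) (α : ℕ →₀ ℕ) [Decidable ((weightSize lam + d * n : ℤ) = α.degree + weightSize mu)] :
    MvPowerSeries.coeff α (∑ᶠ nu ∈ {nu : Fin k → ℕ | nu ∈ dominantWeights k ∧
            (weightSize nu : ℤ) = d * n + weightSize lam - weightSize mu},
          (fusionCoeff n mu nu lam : ℂ) • completeHPart nu) =
      if (weightSize lam + d * n : ℤ) = α.degree + weightSize mu then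
        (orbitCount n mu (fun a => (lam a : ℤ)) (completeProd k α) : ℂ) else 0 := by
  classical
  by_cases hr : ∃ r : ℕ, (weightSize lam + d * n : ℤ) = r + weightSize mu
  · obtain ⟨r, hr⟩ := hr
    have hset : {nu : Fin k → ℕ | nu ∈ dominantWeights k ∧
        (weightSize nu : ℤ) = d * n + weightSize lam - weightSize mu} =
        (((Finset.piAntidiag Finset.univ r).filter fun nu : Fin k → ℕ => Antitone nu :
          Finset (Fin k → ℕ)) : Set (Fin k → ℕ)) := by
      ext nu
      simp only [dominantWeights, Set.mem_ofPred_eq, Finset.coe_filter, Finset.mem_piAntidiag,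
        Finset.mem_univ, implies_true, and_true]
      rw [and_comm]
      refine and_congr_left fun _ => ?_
      change _ ↔ weightSize nu = r
      omega
    rw [hset, finsum_mem_coe_finset, map_sum]
    have hiff : ((weightSize lam + d * n : ℤ) = α.degree + weightSize mu) ↔ α.degree = r := by
      omega
    rw [if_congr hiff rfl rfl, ← Nat.cast_zero, ← Nat.cast_ite, ← sum_piAntidiag_eq_orbitCount, Nat.cast_sum]
    have h1 : ∀ nu ∈ (Finset.piAntidiag Finset.univ r).filter (fun nu : Fin k → ℕ => Antitone nu),
        MvPowerSeries.coeff α ((fusionCoeff n mu nu lam : ℂ) • completeHPart nu) =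
        ∑ G ∈ Finset.piAntidiag Finset.univ r, if ∃ w : Equiv.Perm (Fin k), nu ∘ w = G then
          ((if CongrOrbit n (fun i => (lam i : ℤ) - G i) mu then
            (completeProd k α).coeff (Finsupp.equivFunOnFinite.symm G) else 0 : ℕ) : ℂ) else 0 := by
      intro nu hnu
      simp only [Finset.mem_filter, Finset.mem_piAntidiag, Finset.mem_univ, implies_true,
        and_true] at hnu
      have hsz : weightSize nu = r := hnu.1
      rw [map_smul, fusionCoeff_eq_card hmu hnu.2, hsz, Finset.card_filter, smul_eq_mul,
        Nat.cast_sum, Finset.sum_mul]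
      refine Finset.sum_congr rfl fun G _ => ?_
      by_cases h2 : ∃ w : Equiv.Perm (Fin k), nu ∘ w = G
      · by_cases h3 : CongrOrbit n (fun i => (lam i : ℤ) - G i) mu
        · rw [if_pos ⟨h2, h3⟩, if_pos h2, if_pos h3, ← coeff_completeHPart]
          obtain ⟨w, rfl⟩ := h2
          rw [Finsupp.coe_equivFunOnFinite_symm, completeHPart_comp]; simp
        · rw [if_neg (fun h => h3 h.2), if_pos h2, if_neg h3]; simp
      · rw [if_neg (fun h => h2 h.1), if_neg h2]; simp
    rw [Finset.sum_congr rfl h1, Finset.sum_comm]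
    refine Finset.sum_congr rfl fun G hG => ?_
    simp only [Finset.mem_piAntidiag, Finset.mem_univ, implies_true, and_true] at hG
    obtain ⟨τ, hτ⟩ := exists_antitone_comp G
    have hcomp : (G ∘ τ) ∘ (τ⁻¹ : Equiv.Perm (Fin k)) = G := by funext i; simp
    rw [Finset.sum_eq_single (G ∘ τ), if_pos ⟨τ⁻¹, hcomp⟩]
    · intro nu hnu hne
      rw [if_neg]
      rintro ⟨w, hw⟩
      exact hne (eq_of_antitone_of_comp_eq (Finset.mem_filter.1 hnu).2 hτ (hw.trans hcomp.symm))
    · intro h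
      exfalso; apply h
      simp only [Finset.mem_filter, Finset.mem_piAntidiag, Finset.mem_univ, implies_true,
        and_true]
      exact ⟨(Equiv.sum_comp τ G).trans hG, hτ⟩
  · rw [if_neg fun h => hr ⟨_, h⟩]
    rw [show {nu : Fin k → ℕ | nu ∈ dominantWeights k ∧
        (weightSize nu : ℤ) = d * n + weightSize lam - weightSize mu} = ∅ from ?_]
    · simp
    · ext nu
      simp only [Set.mem_ofPred_eq, Set.mem_empty_iff_false, iff_false, not_and]
      intro _ h
      exact hr ⟨weightSize nu, by omega⟩

/-! ### The action of the principal subalgebra -/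

/-- With s = r mod n one has -n < s - j + i < 2n, so the only multiples of n that occur are 0 and n;
they are the two terms of the definition. -/
theorem heisenbergP_apply (n : ℕ) [NeZero n] (r : ℤ) (i j : Fin n) : heisenbergP n r i j =
    if (n : ℤ) ∣ r - (j : ℕ) + (i : ℕ) then
      LaurentPolynomial.T ((r - (j : ℕ) + (i : ℕ)) / n) else 0 := by
  have hn : (0 : ℤ) < n := by exact_mod_cast Nat.pos_of_ne_zero (NeZero.ne n)
  have h1 := Int.emod_nonneg r hn.ne'
  have h2 := Int.emod_lt_of_pos r hn
  have h3 := Int.emod_add_mul_ediv r n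
  have hi := i.2
  have hj := j.2
  set s := r % (n : ℤ) with hs
  set q := r / (n : ℤ) with hq
  have hdvd : ((n : ℤ) ∣ r - (j : ℕ) + (i : ℕ)) ↔ ((n : ℤ) ∣ s - (j : ℕ) + (i : ℕ)) := by
    rw [show r - ((j : ℕ) : ℤ) + (i : ℕ) = (s - (j : ℕ) + (i : ℕ)) + n * q by linarith]
    exact Int.dvd_add_self_mul
  simp only [heisenbergP, Matrix.of_apply, ← hs, ← hq]
  by_cases c1 : ((j : ℕ) : ℤ) - ((i : ℕ) : ℤ) = s
  · have e : r - (j : ℕ) + (i : ℕ) = n * q := by linarith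
    rw [if_pos c1, if_neg (by omega), e, Int.mul_ediv_cancel_left _ hn.ne', if_pos (dvd_mul_right _ _)]
    simp
  · by_cases c2 : ((i : ℕ) : ℤ) - ((j : ℕ) : ℤ) = n - s
    · have e : r - (j : ℕ) + (i : ℕ) = n * (q + 1) := by linarith
      rw [if_neg c1, if_pos c2, e, Int.mul_ediv_cancel_left _ hn.ne', if_pos (dvd_mul_right _ _)]
      rw [mul_one, zero_add, ← LaurentPolynomial.T_add]
    · rw [if_neg c1, if_neg c2, if_neg]
      · simp
      · rw [hdvd]
        rintro ⟨t, ht⟩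
        have ht1 : t < 2 := by
          by_contra hcon
          have : (n : ℤ) * 2 ≤ n * t := mul_le_mul_of_nonneg_left (by omega) hn.le
          omega
        have ht2 : -1 < t := by
          by_contra hcon
          have : (n : ℤ) * t ≤ n * (-1) := mul_le_mul_of_nonneg_left (by omega) hn.le
          omega
        have : t = 0 ∨ t = 1 := by omega
        rcases this with rfl | rfl
        · apply c1; linarith
        · apply c2; linarith

/-- The vector `v_m` for an arbitrary integer `m`, with `v_{m-n} = z v_m`. -/
def loopVec (n : ℕ) (m : ℤ) : Fin n → ℂ[T;T⁻¹] := fun i =>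
  if (n : ℤ) ∣ (i : ℕ) + 1 - m then LaurentPolynomial.T (((i : ℕ) + 1 - m) / n) else 0

theorem heisenbergP_mulVec (n : ℕ) [NeZero n] (r m : ℤ) :
    (heisenbergP n r).mulVec (loopVec n m) = loopVec n (m - r) := by
  have hn : (0 : ℤ) < n := by exact_mod_cast Nat.pos_of_ne_zero (NeZero.ne n)
  funext i
  obtain ⟨j, q, hm⟩ := exists_eq_add_mul (k := n) 1 m
  rw [Matrix.mulVec, dotProduct, Finset.sum_eq_single j]
  · have e : ((j : ℕ) : ℤ) + 1 - m = n * (-q) := by rw [hm]; ring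
    have e2 : ((i : ℕ) : ℤ) + 1 - (m - r) = (r - (j : ℕ) + (i : ℕ)) + n * (-q) := by rw [hm]; ring
    rw [heisenbergP_apply, loopVec, loopVec, e, if_pos (dvd_mul_right _ _),
      Int.mul_ediv_cancel_left _ hn.ne', e2, Int.add_mul_ediv_left _ _ hn.ne',
      if_congr Int.dvd_add_self_mul rfl rfl, LaurentPolynomial.T_add]
    rw [ite_mul, zero_mul]
  · intro j' _ hj'
    have : ¬ (n : ℤ) ∣ (j' : ℕ) + 1 - m := by
      intro h
      apply hj'
      rw [hm, show ((j' : ℕ) : ℤ) + 1 - (1 + (j : ℕ) + n * q) = ((j' : ℕ) - (j : ℕ)) + n * (-q) by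
        ring, Int.dvd_add_self_mul] at h
      have := Int.eq_zero_of_abs_lt_dvd h (by
        rw [abs_lt]; have := j.2; have := j'.2; constructor <;> omega)
      exact Fin.ext (by omega)
    rw [loopVec, if_neg this, mul_zero]
  · simp

theorem basisVec_eq_loopVec {n m : ℕ} [NeZero n] (hm : 1 ≤ m ∧ m ≤ n) :
    basisVec n m = loopVec n m := by
  funext i
  rw [basisVec, loopVec]
  by_cases h : (i : ℕ) + 1 = m
  · rw [if_pos h, ← h]; simp
  · rw [if_neg h, if_neg]
    intro h'
    have := Int.eq_zero_of_abs_lt_dvd h' (by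
      rw [abs_lt]; have := i.2; constructor <;> omega)
    omega

theorem dualVec_loopVec {n l : ℕ} (hl : 1 ≤ l ∧ l ≤ n) (m : ℤ) :
    dualVec n l (loopVec n m) =
      if (n : ℤ) ∣ l - m then LaurentPolynomial.T ((l - m) / n) else 0 := by
  rw [dualVec, LinearMap.sum_apply, Finset.sum_eq_single ⟨l - 1, by omega⟩]
  · rw [if_pos (by simp; omega), LinearMap.proj_apply, loopVec]
    have : ((l - 1 : ℕ) : ℤ) + 1 = l := by omega
    simp only [this]
  · intro i _ hi
    rw [if_neg, LinearMap.zero_apply]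
    intro h
    exact hi (Fin.ext (by simp; omega))
  · simp

/-- `v_{c_1} ⊗ ... ⊗ v_{c_k}` for integers `c_i`. -/
def loopTensor {k : ℕ} (n : ℕ) (c : Fin k → ℤ) : LoopTensor k n :=
  PiTensorProduct.tprod ℂ[T;T⁻¹] fun i => loopVec n (c i)

theorem loopAction_loopTensor {k n : ℕ} [NeZero n] (r : ℤ) (c : Fin k → ℤ) :
    loopAction k (heisenbergP n r) (loopTensor n c) = ∑ i, loopTensor n (c - Pi.single i r) := by
  rw [loopAction, LinearMap.sum_apply]
  refine Finset.sum_congr rfl fun i _ => ?_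
  rw [loopTensor, PiTensorProduct.map_tprod, loopTensor]
  congr 1
  funext j
  by_cases h : j = i
  · subst h
    simp [heisenbergP_mulVec]
  · simp [h]

/-- The linear map sending the monomial `X^G` to `v_{c - ε G}`. -/
def monomialTensor {k : ℕ} (n : ℕ) (ε : ℤ) (c : Fin k → ℤ) :
    MvPolynomial (Fin k) ℂ[T;T⁻¹] →ₗ[ℂ[T;T⁻¹]] LoopTensor k n :=
  (MvPolynomial.basisMonomials (Fin k) ℂ[T;T⁻¹]).constr ℂ[T;T⁻¹] fun G =>
    loopTensor n fun i => c i - ε * G i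

theorem monomialTensor_monomial {k : ℕ} (n : ℕ) (ε : ℤ) (c : Fin k → ℤ) (G : Fin k →₀ ℕ)
    (a : ℂ[T;T⁻¹]) : monomialTensor n ε c (MvPolynomial.monomial G a) =
      a • loopTensor n fun i => c i - ε * G i := by
  have h1 : monomialTensor n ε c (MvPolynomial.monomial G 1) =
      loopTensor n fun i => c i - ε * G i := by
    have := (MvPolynomial.basisMonomials (Fin k) ℂ[T;T⁻¹]).constr_basis ℂ[T;T⁻¹] (fun G =>
      loopTensor n fun i => c i - ε * G i) G
    rwa [MvPolynomial.coe_basisMonomials] at this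
  rw [show MvPolynomial.monomial G a = a • MvPolynomial.monomial (R := ℂ[T;T⁻¹]) G 1 by
    rw [MvPolynomial.smul_monomial]; simp, map_smul, h1]

/-- On v_c the operator sums the shifts of one index by εr, which is multiplication of the exponent
monomial by x_1^r + ... + x_k^r. The operators thus become multiplications in a commutative ring. -/
theorem loopAction_monomialTensor {k n : ℕ} [NeZero n] (ε : ℤ) (c : Fin k → ℤ) (r : ℕ)
    (p : MvPolynomial (Fin k) ℂ[T;T⁻¹]) :
    loopAction k (heisenbergP n (ε * r)) (monomialTensor n ε c p) =
      monomialTensor n ε c ((∑ i, MvPolynomial.X i ^ r) * p) := by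
  induction p using MvPolynomial.induction_on' with
  | monomial G a =>
    rw [monomialTensor_monomial, map_smul, loopAction_loopTensor, Finset.sum_mul, map_sum,
      Finset.smul_sum]
    refine Finset.sum_congr rfl fun i _ => ?_
    rw [MvPolynomial.X_pow_eq_monomial, MvPolynomial.monomial_mul, one_mul, monomialTensor_monomial]
    congr 2
    funext j
    by_cases h : j = i
    · subst h; simp; ring
    · simp [h, Finsupp.single_eq_of_ne h]
  | add p q hp hq => rw [mul_add, map_add, map_add, map_add, hp, hq]

theorem list_prod_apply_of_intertwine {ι R M A : Type*} [CommSemiring R] [AddCommMonoid M]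
    [Module R M] [Monoid A] (Φ : A → M) (f : ι → Module.End R M) (g : ι → A)
    (h : ∀ i a, f i (Φ a) = Φ (g i * a)) (L : List ι) (a : A) :
    (L.map f).prod (Φ a) = Φ ((L.map g).prod * a) := by
  induction L generalizing a with
  | nil => simp
  | cons i L ih =>
    rw [List.map_cons, List.prod_cons, Module.End.mul_apply, ih, h, List.map_cons, List.prod_cons,
      mul_assoc]

theorem opH_monomialTensor {k n : ℕ} [NeZero n] (ε : ℤ) (c : Fin k → ℤ) (r : ℕ)
    (p : MvPolynomial (Fin k) ℂ[T;T⁻¹]) :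
    opH k n ε r (monomialTensor n ε c p) =
      monomialTensor n ε c (MvPolynomial.eval₂Hom (Nat.castRingHom _) MvPolynomial.X (completePoly k r) * p) := by
  rw [← partitionSum_psum, partitionSum, opH, LinearMap.sum_apply, Finset.sum_mul, map_sum]
  refine Finset.sum_congr rfl fun ρ _ => ?_
  -- In `opH` the list of parts is coerced to integers as a monadic bind, here rewritten as a map.
  have hcast : ∀ L : List ℕ, (do let a ← L; pure (a : ℤ)) = L.map fun a : ℕ => (a : ℤ) := by
    intro L
    simp only [List.bind_eq_flatMap, List.pure_def, List.map_eq_flatMap]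
  rw [LinearMap.smul_apply, hcast, List.map_map]
  simp only [Function.comp_def]
  rw [list_prod_apply_of_intertwine (monomialTensor n ε c) _ _
    (fun (j : ℕ) p => loopAction_monomialTensor ε c j p), ← map_smul, ← Multiset.prod_coe,
    ← Multiset.map_coe, Multiset.sort_eq, smul_mul_assoc]
  congr 1
  exact algebraMap_smul (R := ℂ) ℂ[T;T⁻¹] _ _

theorem opHProd_monomialTensor {k n : ℕ} [NeZero n] (ε : ℤ) (c : Fin k → ℤ) (α : ℕ →₀ ℕ)
    (p : MvPolynomial (Fin k) ℂ[T;T⁻¹]) :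
    opHProd k n ε α (monomialTensor n ε c p) =
      monomialTensor n ε c (MvPolynomial.eval₂Hom (Nat.castRingHom _) MvPolynomial.X (completeProd k α) * p) := by
  rw [opHProd, list_prod_apply_of_intertwine (monomialTensor n ε c) _ _
    (fun j p => opH_monomialTensor ε c (α j) p)]
  congr 2
  rw [completeProd, Finsupp.prod, map_prod, Finset.prod_eq_multiset_prod, ← Finset.sort_eq (s := α.support) (r := (· ≤ ·)), Multiset.map_coe,
    Multiset.prod_coe]

theorem opHProd_loopTensor {k n : ℕ} [NeZero n] (ε : ℤ) (c : Fin k → ℤ) (α : ℕ →₀ ℕ) :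
    opHProd k n ε α (loopTensor n c) = ∑ G ∈ (completeProd k α).support,
      (completeProd k α).coeff G • loopTensor n fun i => c i - ε * G i := by
  have h0 : loopTensor n c = monomialTensor n ε c 1 := by
    rw [← MvPolynomial.C_1, ← MvPolynomial.monomial_zero', monomialTensor_monomial]
    simp
  rw [h0, opHProd_monomialTensor, mul_one]
  conv_lhs => rw [(completeProd k α).as_sum, map_sum, map_sum]
  refine Finset.sum_congr rfl fun G _ => ?_
  rw [MvPolynomial.eval₂Hom_monomial, eq_natCast, ← nsmul_eq_mul, map_nsmul]
  congr 1
  have : (G.prod fun i e => (MvPolynomial.X i : MvPolynomial (Fin k) ℂ[T;T⁻¹]) ^ e) =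
      MvPolynomial.monomial G 1 := by
    rw [MvPolynomial.monomial_eq]; simp
  rw [this, monomialTensor_monomial, one_smul]

/-! ### Matrix elements -/

open Classical in
-- The stabiliser of M is the product of the symmetric groups of its level sets.
theorem quantumDim_mul_card_stabilizer {k n : ℕ} {M : Fin k → ℕ} (hM : ∀ i, 1 ≤ M i ∧ M i ≤ n) :
    quantumDim n M * ((Finset.univ.filter fun w : Equiv.Perm (Fin k) => M ∘ w = M).card : ℂ) =
      (k ! : ℂ) := by
  have h1 : (Finset.univ.filter fun w : Equiv.Perm (Fin k) => M ∘ w = M).card =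
      ∏ m ∈ Finset.Icc 1 n, (Finset.univ.filter fun i => M i = m).card ! := by
    rw [← Fintype.card_subtype, DomMulAct.stabilizer_card']
    simp only [Fintype.card_subtype]
    refine Finset.prod_subset ?_ ?_
    · intro m hm
      obtain ⟨i, -, rfl⟩ := Finset.mem_image.1 hm
      exact Finset.mem_Icc.2 (hM i)
    · intro m _ hm
      rw [Finset.filter_eq_empty_iff.2, Finset.card_empty, Nat.factorial_zero]
      intro i _ h
      exact hm (Finset.mem_image.2 ⟨i, Finset.mem_univ i, h⟩)
  rw [h1, quantumDim, div_mul_cancel₀]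
  exact_mod_cast Finset.prod_ne_zero_iff.2 fun m _ => Nat.factorial_ne_zero _

open Classical in
theorem card_filter_congr {k n : ℕ} {M : Fin k → ℕ} (hM : ∀ i, 1 ≤ M i ∧ M i ≤ n) (x : Fin k → ℤ) :
    (Finset.univ.filter fun w : Equiv.Perm (Fin k) => ∀ i, (n : ℤ) ∣ x i - M (w i)).card =
      if CongrOrbit n x M then
        (Finset.univ.filter fun w : Equiv.Perm (Fin k) => M ∘ w = M).card else 0 := by
  split_ifs with h
  · obtain ⟨σ, hσ⟩ := h
    refine Finset.card_bij' (fun w _ => w * σ⁻¹) (fun w _ => w * σ) ?_ ?_ (fun _ _ => by simp)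
      (fun _ _ => by simp)
    · intro w hw
      simp only [Finset.mem_filter, Finset.mem_univ, true_and] at hw ⊢
      funext i
      have h1 := dvd_sub (hσ (σ⁻¹ i)) (hw (σ⁻¹ i))
      refine eq_of_dvd_sub (hM _) (hM _) ?_
      simpa using h1
    · intro w hw
      simp only [Finset.mem_filter, Finset.mem_univ, true_and] at hw ⊢
      intro i
      have := congrFun hw (σ i)
      simp only [Function.comp_apply] at this
      rw [Equiv.Perm.mul_apply, this]
      exact hσ i
  · rw [Finset.card_eq_zero, Finset.filter_eq_empty_iff]
    intro w _ hw
    exact h ⟨w, hw⟩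

theorem dividedPower_eq_sum {k n : ℕ} [NeZero n] {M : Fin k → ℕ} (hM : ∀ i, 1 ≤ M i ∧ M i ≤ n) :
    dividedPower n M = (LaurentPolynomial.C (quantumDim n M * (k ! : ℂ)⁻¹) : ℂ[T;T⁻¹]) •
      ∑ w : Equiv.Perm (Fin k), loopTensor n fun i => (M (w i) : ℤ) := by
  rw [dividedPower]
  congr 1
  rw [← Equiv.sum_comp (Equiv.mulLeft Fin.revPerm) (fun w : Equiv.Perm (Fin k) =>
    loopTensor n fun i => (M (w i) : ℤ))]
  refine Finset.sum_congr rfl fun w _ => ?_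
  rw [loopTensor]
  congr 1
  funext i
  exact basisVec_eq_loopVec (hM _)

theorem prod_ite_dvd_T {k n : ℕ} [NeZero n] (a : Fin k → ℤ) [Decidable (∀ i, (n : ℤ) ∣ a i)] :
    (∏ i, if (n : ℤ) ∣ a i then (LaurentPolynomial.T (a i / n) : ℂ[T;T⁻¹]) else 0) =
      if ∀ i, (n : ℤ) ∣ a i then LaurentPolynomial.T ((∑ i, a i) / n) else 0 := by
  have hn : (n : ℤ) ≠ 0 := by exact_mod_cast NeZero.ne n
  split_ifs with h
  · choose q hq using h
    have h1 : ∀ s : Finset (Fin k), (∏ i ∈ s, (LaurentPolynomial.T (q i) : ℂ[T;T⁻¹])) =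
        LaurentPolynomial.T (∑ i ∈ s, q i) := by
      intro s
      classical
      induction s using Finset.induction_on with
      | empty => simp
      | insert i s hi ih => rw [Finset.prod_insert hi, Finset.sum_insert hi, ih,
          LaurentPolynomial.T_add]
    simp only [hq, ← Finset.mul_sum, Int.mul_ediv_cancel_left _ hn, dvd_mul_right, if_true, h1]
  · push Not at h
    obtain ⟨i, hi⟩ := h
    exact Finset.prod_eq_zero (Finset.mem_univ i) (if_neg hi)

open Classical in
theorem dualPower_loopTensor {k n : ℕ} [NeZero n] {L : Fin k → ℕ} (hL : ∀ i, 1 ≤ L i ∧ L i ≤ n)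
    (c : Fin k → ℤ) : dualPower n L (loopTensor n c) =
      LaurentPolynomial.C ((k ! : ℂ)⁻¹) * ∑ w : Equiv.Perm (Fin k),
        if ∀ i, (n : ℤ) ∣ L (w i) - c i then
          LaurentPolynomial.T ((weightSize L - ∑ i, c i) / n) else 0 := by
  rw [dualPower, LinearMap.smul_apply, LinearMap.sum_apply, smul_eq_mul]
  congr 1
  rw [← Equiv.sum_comp (Equiv.mulRight Fin.revPerm) (fun w : Equiv.Perm (Fin k) =>
    if ∀ i, (n : ℤ) ∣ L (w i) - c i then
      (LaurentPolynomial.T ((weightSize L - ∑ i, c i) / n) : ℂ[T;T⁻¹]) else 0)]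
  refine Finset.sum_congr rfl fun w _ => ?_
  rw [loopTensor, PiTensorProduct.dualDistrib_apply]
  simp only [dualVec_loopVec (hL _)]
  rw [prod_ite_dvd_T, Finset.sum_sub_distrib]
  have h1 : ∑ i, (L (w (Fin.rev i)) : ℤ) = weightSize L := by
    rw [weightSize]
    push_cast
    exact Equiv.sum_comp (Fin.revPerm.trans w) fun i => (L i : ℤ)
  rw [h1]
  rfl

open Classical in
theorem matrixElement_eq {k n : ℕ} [NeZero n] (ε : ℤ) {L M : Fin k → ℕ}
    (hL : ∀ i, 1 ≤ L i ∧ L i ≤ n) (hM : ∀ i, 1 ≤ M i ∧ M i ≤ n) (α : ℕ →₀ ℕ) :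
    matrixElement n ε L M α = LaurentPolynomial.C ((k ! : ℂ)⁻¹ *
      ((∑ w : Equiv.Perm (Fin k), ∑ G ∈ (completeProd k α).support,
        if CongrOrbit n (fun i => L (w i) + ε * G i) M then (completeProd k α).coeff G else 0 : ℕ) :
          ℂ)) * LaurentPolynomial.T ((weightSize L - weightSize M + ε * α.degree) / n) := by
  set K := completeProd k α with hK
  set e : ℤ := (weightSize L - weightSize M + ε * α.degree) / n with he
  have hdeg : ∀ G ∈ K.support, ∑ i, (G i : ℤ) = α.degree := by
    intro G hG
    have h1 := completeProd_isHomogeneous k α (MvPolynomial.mem_support_iff.1 hG)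
    replace h1 : G.degree = α.degree := by rw [Finsupp.degree_eq_weight_one]; exact h1
    rw [← h1, Finsupp.degree_eq_sum]
    push_cast; rfl
  have hstep : matrixElement n ε L M α =
      LaurentPolynomial.C (quantumDim n M * (k ! : ℂ)⁻¹) * (LaurentPolynomial.C ((k ! : ℂ)⁻¹) *
        ∑ w : Equiv.Perm (Fin k), ∑ G ∈ K.support, ∑ w' : Equiv.Perm (Fin k),
          K.coeff G • if ∀ i, (n : ℤ) ∣ (L (w i) + ε * G i) - M (w' i) then
            (LaurentPolynomial.T e : ℂ[T;T⁻¹]) else 0) := by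
    rw [matrixElement, dividedPower_eq_sum hM, map_smul, map_smul, smul_eq_mul]
    congr 1
    simp only [map_sum, opHProd_loopTensor, map_nsmul, dualPower_loopTensor hL, Finset.mul_sum]
    rw [Finset.sum_comm, Finset.sum_comm (s := Finset.univ) (t := K.support)]
    refine Finset.sum_congr rfl fun G hG => ?_
    simp only [Finset.smul_sum]
    rw [Finset.sum_comm]
    refine Finset.sum_congr rfl fun w _ => Finset.sum_congr rfl fun w' _ => ?_
    rw [mul_smul_comm]
    congr 2
    refine if_congr (forall_congr' fun i => ?_) ?_ rfl
    · rw [sub_sub_eq_add_sub]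
    · congr 1
      rw [he, Finset.sum_sub_distrib, ← Finset.mul_sum, hdeg G hG]
      have h1 : ∑ i, (M (w' i) : ℤ) = weightSize M := by
        rw [weightSize]
        push_cast
        exact Equiv.sum_comp w' fun i => (M i : ℤ)
      rw [h1]
      ring_nf
  set st := (Finset.univ.filter fun w : Equiv.Perm (Fin k) => M ∘ w = M).card with hst
  have hinner : ∀ (w : Equiv.Perm (Fin k)) (G : Fin k →₀ ℕ), (∑ w' : Equiv.Perm (Fin k),
      K.coeff G • if ∀ i, (n : ℤ) ∣ (L (w i) + ε * G i) - M (w' i) then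
        (LaurentPolynomial.T e : ℂ[T;T⁻¹]) else 0) =
      (st * if CongrOrbit n (fun i => L (w i) + ε * G i) M then K.coeff G else 0) •
        (LaurentPolynomial.T e : ℂ[T;T⁻¹]) := by
    intro w G
    rw [← Finset.smul_sum, ← Finset.sum_filter, Finset.sum_const,
      card_filter_congr hM (fun i => L (w i) + ε * G i), smul_smul, ← hst]
    congr 1
    split_ifs <;> ring
  rw [hstep]
  simp only [hinner]
  simp only [← Finset.sum_smul, ← Finset.mul_sum]
  rw [← Nat.cast_smul_eq_nsmul ℂ, LaurentPolynomial.smul_eq_C_mul, ← mul_assoc, ← mul_assoc,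
    ← map_mul, ← map_mul]
  congr 2
  have hq := quantumDim_mul_card_stabilizer (n := n) hM
  rw [← hst] at hq
  have hk : (k ! : ℂ) ≠ 0 := by exact_mod_cast Nat.factorial_ne_zero k
  have hcancel : ∀ q s a S : ℂ, a ≠ 0 → q * s = a → q * a⁻¹ * a⁻¹ * (s * S) = a⁻¹ * S := by
    rintro q s a S ha rfl
    field_simp
  rw [Nat.cast_mul]
  exact hcancel _ _ _ _ hk hq

/-- The product of complete polynomials is symmetric, so all k! terms of the average in v^λ agree.
-/
theorem sum_perm_orbitCount {k n : ℕ} {lam mu : Fin k → ℕ} (α : ℕ →₀ ℕ)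
    (e : Equiv.Perm (Fin k) → Equiv.Perm (Fin k)) :
    (∑ w : Equiv.Perm (Fin k),
      orbitCount n mu (fun i => (lam (e w i) : ℤ)) (completeProd k α)) =
      k ! * orbitCount n mu (fun i => (lam i : ℤ)) (completeProd k α) := by
  have : ∀ w : Equiv.Perm (Fin k),
      orbitCount n mu (fun i => (lam (e w i) : ℤ)) (completeProd k α) =
        orbitCount n mu (fun i => (lam i : ℤ)) (completeProd k α) := fun w =>
    (orbitCount_comp n mu (fun i => (lam i : ℤ)) (e w) _).trans (by rw [rename_completeProd])
  simp only [this, Finset.sum_const, Finset.card_univ, Fintype.card_perm, Fintype.card_fin,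
    smul_eq_mul]

theorem matrixElement_neg_one {k n : ℕ} [NeZero n] {lam mu : Fin k → ℕ} (hlam : lam ∈ alcove k n)
    (hmu : mu ∈ alcove k n) (α : ℕ →₀ ℕ) : matrixElement n (-1) lam mu α =
      LaurentPolynomial.C (orbitCount n mu (fun i => (lam i : ℤ)) (completeProd k α) : ℂ) *
        LaurentPolynomial.T (-((α.degree + weightSize mu - weightSize lam : ℤ)) / n) := by
  classical
  have hk : (k ! : ℂ) ≠ 0 := by exact_mod_cast Nat.factorial_ne_zero k
  rw [matrixElement_eq (-1) hlam.2 hmu.2]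
  congr 2
  · have h1 := sum_perm_orbitCount (n := n) (lam := lam) (mu := mu) α id
    simp only [id, orbitCount_eq_sum] at h1
    simp only [neg_mul, one_mul, ← sub_eq_add_neg]
    rw [h1, ← orbitCount_eq_sum]
    push_cast
    rw [inv_mul_cancel_left₀ hk]
  · congr 1; ring

theorem weightSize_weightVee {k n : ℕ} {lam : Fin k → ℕ} (hlam : lam ∈ alcove k n) :
    (weightSize (weightVee n lam) : ℤ) = k * (n + 1) - weightSize lam := by
  have h1 : ∀ i, (weightVee n lam i : ℤ) = n + 1 - lam (Fin.revPerm i) := fun i => by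
    have := (hlam.2 (Fin.rev i)).2
    simp only [weightVee, Fin.revPerm_apply]
    omega
  simp only [weightSize]
  push_cast
  simp only [h1, Finset.sum_sub_distrib]
  rw [Equiv.sum_comp Fin.revPerm fun i => (lam i : ℤ)]
  simp

/-- Since λ^∨ is n + 1 - λ reversed, the condition that λ^∨ + G lies in the orbit of μ^∨ is the
negative of the condition that λ - G lies in the orbit of μ; the reversal is absorbed into the
permutations. -/
theorem matrixElement_one {k n : ℕ} [NeZero n] {lam mu : Fin k → ℕ} (hlam : lam ∈ alcove k n)
    (hmu : mu ∈ alcove k n) (α : ℕ →₀ ℕ) :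
    matrixElement n 1 (weightVee n lam) (weightVee n mu) α =
      LaurentPolynomial.C (orbitCount n mu (fun i => (lam i : ℤ)) (completeProd k α) : ℂ) *
        LaurentPolynomial.T ((α.degree + weightSize mu - weightSize lam : ℤ) / n) := by
  classical
  have hk : (k ! : ℂ) ≠ 0 := by exact_mod_cast Nat.factorial_ne_zero k
  have hvee : ∀ {nu : Fin k → ℕ}, nu ∈ alcove k n → ∀ i, 1 ≤ weightVee n nu i ∧
      weightVee n nu i ≤ n := fun {nu} h i => by
    have := h.2 (Fin.rev i)
    simp only [weightVee]
    omega
  have hval : ∀ {nu : Fin k → ℕ}, nu ∈ alcove k n → ∀ i, (weightVee n nu i : ℤ) =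
      n + 1 - nu (Fin.rev i) := fun {nu} h i => by
    have := (h.2 (Fin.rev i)).2
    simp only [weightVee]
    omega
  rw [matrixElement_eq 1 (hvee hlam) (hvee hmu)]
  congr 2
  · have h1 := sum_perm_orbitCount (n := n) (lam := lam) (mu := mu) α (fun w => Fin.revPerm * w)
    simp only [orbitCount_eq_sum] at h1
    rw [← orbitCount_eq_sum] at h1
    have h2 : ∀ (w : Equiv.Perm (Fin k)) (G : Fin k →₀ ℕ),
        CongrOrbit n (fun i => (weightVee n lam (w i) : ℤ) + 1 * G i) (weightVee n mu) ↔
          CongrOrbit n (fun i => (lam ((Fin.revPerm * w : Equiv.Perm (Fin k)) i) : ℤ) - G i) mu := by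
      intro w G
      have key : ∀ (σ : Equiv.Perm (Fin k)) (i : Fin k),
          ((n : ℤ) ∣ (weightVee n lam (w i) : ℤ) + 1 * G i - weightVee n mu (σ i)) ↔
          ((n : ℤ) ∣ (lam ((Fin.revPerm * w : Equiv.Perm (Fin k)) i) : ℤ) - G i - mu ((Fin.revPerm * σ : Equiv.Perm (Fin k)) i)) := by
        intro σ i
        rw [hval hlam, hval hmu, ← dvd_neg]
        simp only [Equiv.Perm.mul_apply, Fin.revPerm_apply]
        ring_nf
      constructor
      · rintro ⟨σ, hσ⟩
        exact ⟨Fin.revPerm * σ, fun i => (key σ i).1 (hσ i)⟩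
      · rintro ⟨σ, hσ⟩
        refine ⟨Fin.revPerm * σ, fun i => (key _ i).2 ?_⟩
        simpa using hσ i
    simp only [h2]
    rw [h1]
    push_cast
    rw [inv_mul_cancel_left₀ hk]
  · rw [weightSize_weightVee hlam, weightSize_weightVee hmu]
    congr 1; ring

/-! ### The generating series in z and the theorem -/

theorem exists_degree_of_orbitCount_ne_zero {k n : ℕ} [NeZero n] {lam mu : Fin k → ℕ}
    (hlam : lam ∈ alcove k n) (hmu : mu ∈ alcove k n) {α : ℕ →₀ ℕ}
    (h : orbitCount n mu (fun i => (lam i : ℤ)) (completeProd k α) ≠ 0) :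
    ∃ D : ℕ, weightSize lam + D * n = α.degree + weightSize mu := by
  classical
  rw [orbitCount_eq_sum] at h
  obtain ⟨G, hG, hne⟩ := Finset.exists_ne_zero_of_sum_ne_zero h
  have hc : CongrOrbit n (fun i => (lam i : ℤ) - G i) mu := by
    by_contra hcon
    exact hne (if_neg hcon)
  obtain ⟨D, hD⟩ := CongrOrbit.exists_degree hlam hmu hc
  have h1 := completeProd_isHomogeneous k α (MvPolynomial.mem_support_iff.1 hG)
  replace h1 : G.degree = α.degree := by rw [Finsupp.degree_eq_weight_one]; exact h1
  exact ⟨D, by rw [hD, ← h1, Finsupp.degree_eq_sum]⟩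

/-- At most one d satisfies the size condition. If the count is nonzero such a d exists and the
division by n is exact; if it is zero both sides vanish, whatever the rounded exponent. -/
theorem cylHSeries_eq {k n : ℕ} [NeZero k] [NeZero n] {lam mu : Fin k → ℕ} (hlam : lam ∈ alcove k n)
    (hmu : mu ∈ alcove k n) (α : ℕ →₀ ℕ) : cylHSeries n lam mu α =
      LaurentPolynomial.C (orbitCount n mu (fun i => (lam i : ℤ)) (completeProd k α) : ℂ) *
        LaurentPolynomial.T ((α.degree + weightSize mu - weightSize lam : ℤ) / n) := by
  classical
  have hn : (n : ℤ) ≠ 0 := by exact_mod_cast NeZero.ne n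
  rw [cylHSeries]
  simp only [coeff_cylH hlam hmu]
  by_cases h : orbitCount n mu (fun i => (lam i : ℤ)) (completeProd k α) = 0
  · simp [h]
  · obtain ⟨D, hD⟩ := exists_degree_of_orbitCount_ne_zero hlam hmu h
    have hD' : (weightSize lam + (D : ℤ) * n : ℤ) = α.degree + weightSize mu := by exact_mod_cast hD
    rw [finsum_eq_single _ D, if_pos hD']
    · congr 2
      rw [← hD', show (weightSize lam + (D : ℤ) * n - weightSize lam : ℤ) = n * D by ring,
        Int.mul_ediv_cancel_left _ hn]
    · intro d hd
      rw [if_neg, map_zero, zero_mul]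
      intro h'
      apply hd
      have : ((d : ℤ)) * n = D * n := by linarith
      exact_mod_cast mul_right_cancel₀ hn this

theorem laurentBar_C_mul_T (a : ℕ) (m : ℤ) :
    laurentBar (LaurentPolynomial.C (a : ℂ) * LaurentPolynomial.T m) =
      LaurentPolynomial.C (a : ℂ) * LaurentPolynomial.T (-m) := by
  rw [laurentBar, LaurentPolynomial.eval₂_C_mul_T]
  congr 1
  · simp
  · induction m using Int.induction_on with
    | zero => simp
    | succ m ih =>
      rw [zpow_add_one, Units.val_mul, ih, ← LaurentPolynomial.T_add]
      congr 1; ring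
    | pred m ih =>
      rw [zpow_sub_one, Units.val_mul, ih, Units.inv_mk, ← LaurentPolynomial.T_add]
      congr 1; ring

theorem mainTheorem2 (k n : ℕ) [NeZero k] [NeZero n] (lam mu : Fin k → ℕ)
    (hlam : lam ∈ alcove k n) (hmu : mu ∈ alcove k n) :
    (∀ d : ℕ,
      (∀ α : ℕ →₀ ℕ, (cylRPPOfWeight n lam (d : ℤ) mu α).Finite) ∧
      IsSymmetricFunction (cylH n lam (d : ℤ) mu) ∧
      cylH n lam (d : ℤ) mu =
        ∑ᶠ nu ∈ {nu : Fin k → ℕ | nu ∈ dominantWeights k ∧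
            (weightSize nu : ℤ) = (d : ℤ) * n + weightSize lam - weightSize mu},
          (fusionCoeff n mu nu lam : ℂ) • completeHPart nu) ∧
    (∀ α : ℕ →₀ ℕ,
      {d : ℕ | MvPowerSeries.coeff α (cylH n lam (d : ℤ) mu) ≠ 0}.Finite) ∧
    matrixElement n 1 (weightVee n lam) (weightVee n mu) = cylHSeries n lam mu ∧
    MvPowerSeries.map laurentBar (matrixElement n (-1) lam mu) = cylHSeries n lam mu := by
  classical
  have hn : (n : ℤ) ≠ 0 := by exact_mod_cast NeZero.ne n
  refine ⟨fun d => ⟨cylRPPOfWeight_finite lam d mu, ⟨⟨weightSize lam + d * n, fun α hα => ?_⟩,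
    fun σ α => ?_⟩, ?_⟩, fun α => ?_, ?_, ?_⟩
  · rw [coeff_cylH hlam hmu, if_neg]
    intro h
    have h' : weightSize lam + d * n = α.degree + weightSize mu := by exact_mod_cast h
    omega
  · rw [coeff_cylH hlam hmu, coeff_cylH hlam hmu, completeProd_mapDomain]
    have hdeg : (α.mapDomain σ).degree = α.degree := by
      simp only [Finsupp.degree_apply]
      exact Finsupp.sum_mapDomain_index_inj (h := fun _ r => r) σ.injective
    rw [hdeg]
  · ext α
    rw [coeff_cylH hlam hmu, coeff_sum_fusionCoeff hmu]
  · refine Set.Subsingleton.finite fun d hd d' hd' => ?_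
    have key : ∀ d : ℕ, MvPowerSeries.coeff α (cylH n lam (d : ℤ) mu) ≠ 0 →
        (weightSize lam + (d : ℤ) * n : ℤ) = α.degree + weightSize mu := by
      intro d hd
      by_contra h
      exact hd (by rw [coeff_cylH hlam hmu, if_neg h])
    have h1 := key d hd
    have h2 := key d' hd'
    exact_mod_cast mul_right_cancel₀ hn (show (d : ℤ) * n = d' * n by linarith)
  · funext α
    rw [matrixElement_one hlam hmu, cylHSeries_eq hlam hmu]
  · funext α
    change laurentBar (matrixElement n (-1) lam mu α) = _
    rw [matrixElement_neg_one hlam hmu, cylHSeries_eq hlam hmu, laurentBar_C_mul_T]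
    -- Integer division does not commute with negation in general. The exponents need to agree only
    -- when the count is nonzero, and then the division is exact.
    by_cases h : orbitCount n mu (fun i => (lam i : ℤ)) (completeProd k α) = 0
    · simp [h]
    · obtain ⟨D, hD⟩ := exists_degree_of_orbitCount_ne_zero hlam hmu h
      have hD' : (weightSize lam + (D : ℤ) * n : ℤ) = α.degree + weightSize mu := by
        exact_mod_cast hD
      congr 2
      rw [← hD', show (weightSize lam + (D : ℤ) * n - weightSize lam : ℤ) = n * D by ring,
        Int.mul_ediv_cancel_left _ hn, ← mul_neg, Int.mul_ediv_cancel_left _ hn, neg_neg]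

end
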